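/- For $\mathfrak{p}\in[-1,1]$ define $h^\downarrow_{\mathfrak{p}}:\mathbb{Z}_{\ge 0}\to\mathbb{R}$ by $h^\downarrow_{\mathfrak{p}}(0)=1$ and, for $p\ge 1$, \[ h^\downarrow_{\mathfrak{p}}(p)=\frac{1}{1+\mathfrak{p}}\,\frac{\Gamma(b)}{\Gamma(2p+1)\,\Gamma(b-2p)}\;{}_2F_1(-2p,\,b-1;\,b-2p;\,-1)\quad(\mathfrak{p}\in(-1,1)), \] \[ h^\downarrow_{1}(p)=1,\qquad h^\downarrow_{-1}(p)=\frac{4}{\pi^2p}\sum_{j=1}^{p}\frac{1}{2j-1}, \] where $b=\frac1\pi\arccos\mathfrak{p}$ and ${}_2F_1$ is the hypergeometric function. For $k\ge 1$ consider the simple random walk on $\mathbb{Z}^2$ started at $(k,k)$ and killed upon hitting the origin, which happens almost surely. Let $\Theta$ be the total winding angle of the killed walk around the origin, i.e. the sum over the steps before the final step into the origin of the signed angles under which these steps are seen from the origin, and let $[\Theta]\in\pi(\mathbb{Z}+\frac12)$ be $\Theta$ rounded to the nearest half-integer multiple of $\pi$. Then for every $k\ge 1$ and every $\beta\in\mathbb{R}$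 \[ \mathbb{E}\left[e^{i\beta[\Theta]}\right]=\cos\left(\tfrac{\pi\beta}{2}\right)h^\downarrow_{\cos(\pi\beta)}(k). \] Moreover, as $k\to\infty$, $\Theta/\log k$ converges in distribution to a standard Cauchy random variable, that is, one with density $\frac{1}{\pi}\frac{1}{1+x^2}$ on $\mathbb{R}$. -/

import Mathlib

open MeasureTheory ProbabilityTheory Filter

/-- `X` is, under the probability measure `P`, a simple random walk on `ℤ²` started at `x`: the
increments are independent, and each of them is uniform on the four unit vectors. -/
structure IsSimpleRandomWalk {Ω : Type*} [MeasurableSpace Ω] (P : Measure Ω)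
    (X : ℕ → Ω → ℤ × ℤ) (x : ℤ × ℤ) : Prop where
  measurable : ∀ n, Measurable (X n)
  initial : ∀ᵐ ω ∂P, X 0 ω = x
  indep : iIndepFun (fun n ω => X (n + 1) ω - X n ω) P
  uniform : ∀ n, ∀ e ∈ ({(1, 0), (-1, 0), (0, 1), (0, -1)} : Finset (ℤ × ℤ)),
    P {ω | X (n + 1) ω - X n ω = e} = 1 / 4

/-- A point of `ℤ²`, seen as a point of the complex plane. -/
def latticePoint (v : ℤ × ℤ) : ℂ := ⟨(v.1 : ℝ), (v.2 : ℝ)⟩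

/-- The first time at which the path `x` visits the origin (`0` if there is none). -/
noncomputable def hittingTimeOrigin (x : ℕ → ℤ × ℤ) : ℕ := sInf {n | x n = 0}

/-- The winding angle around the origin of the first `n` steps of a path: the sum of the signed
angles in `(-π, π]` under which the successive steps are seen from the origin. For a step between
distinct adjacent lattice points different from `0` this is the increment of a continuous
determination of the argument along the segment, since the segment avoids `0`. -/
noncomputable def windingAngle (x : ℕ → ℤ × ℤ) (n : ℕ) : ℝ :=
  ∑ i ∈ Finset.range n, Complex.arg (latticePoint (x (i + 1)) / latticePoint (x i))

/-- The total winding angle around the origin of a path killed when it first visits the origin.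
The last step, which runs radially into the origin, does not contribute. -/
noncomputable def totalWindingAngle (x : ℕ → ℤ × ℤ) : ℝ :=
  windingAngle x (hittingTimeOrigin x - 1)

/-- `θ` rounded to the nearest element of `π (ℤ + 1/2)`. An integer multiple of `π`, which has two
nearest elements, is rounded up. -/
noncomputable def roundHalfPi (θ : ℝ) : ℝ := Real.pi * ((⌊θ / Real.pi⌋ : ℝ) + 1 / 2)

/-- The functions `h^↓_𝔭 : ℤ_{≥0} → ℝ`, for `𝔭 ∈ [-1, 1]`. -/
noncomputable def hDown (𝔭 : ℝ) (p : ℕ) : ℝ :=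
  if p = 0 then 1
  else if 𝔭 = 1 then 1
  else if 𝔭 = -1 then
    4 / (Real.pi ^ 2 * p) * ∑ j ∈ Finset.Icc 1 p, 1 / (2 * (j : ℝ) - 1)
  else
    let b : ℝ := Real.arccos 𝔭 / Real.pi
    1 / (1 + 𝔭) * (Real.Gamma b / (Real.Gamma (2 * (p : ℝ) + 1) * Real.Gamma (b - 2 * (p : ℝ)))) *
      ordinaryHypergeometric (-2 * (p : ℝ)) (b - 1) (b - 2 * (p : ℝ)) (-1 : ℝ)

/-! In the diagonal coordinates u = x + y, v = y - x every step changes both u and v by ±1, and the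
walk starts on the ray u > 0, v = 0. Lift it to the universal cover of the punctured lattice, with
the angle θ measured from that ray, and let the m-th half plane be mπ ≤ θ < (m+1)π. For 0 < b ≤ 1
there is a bounded harmonic function on the cover which takes the value e^{ibπ(m+1/2)} at the origin
reached from the m-th half plane. Along the walk it is a bounded martingale that ends at e^{ib[Θ]},
so the expectation sought is its value at the starting point.

On one half plane the function is a superposition of the decaying solutions λ(φ)^v e^{-iuφ} with
weight cot(φ/2)^{1-b} (`halfPlaneKernel`), normalized to 1 at the origin. An integration by parts
gives the boundary values a real three-term recurrence (`halfPlaneKernel_recurrence`). It propagates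
the phase e^{-iπb/2} along u > 0, and conjugation gives the opposite phase on u < 0. With these
phases the copies multiplied by e^{ibπ(m+1/2)} agree on the common rays and are harmonic across them
(`extendedKernel_harmonic`, `coverHarmonic_mean`). The same recurrence governs the Taylor
coefficients of ((1+x)/(1-x))^{1-b}, and expanding that function as a product of binomial series
produces the terminating hypergeometric sum (`hypergeometric_eq_cotSeries`).

Recurrence of the walk is a by-product. The function decays in |v|, and v leaves every finite set in
probability, so its starting value is at most the probability of hitting the origin; as b → 0 this
value tends to 1 (`le_measure_hits`, `ae_hits`). Other real β reduce to b ∈ [0,1], because [Θ] is a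
half-integer multiple of π and the answer is real.

For the limit law put β = t / log k. Bounds on the Taylor coefficients that are uniform in β give
the limit e^{-|t|}, the Cauchy characteristic function. Rounding moves Θ by at most π/2, which is
negligible after division by log k. -/

/-! ### Markov chains driven by uniform unit steps; escape of the coordinate y - x. -/

section MarkovChain

/-- The four unit vectors of `ℤ²`. -/
def unitSteps : Finset (ℤ × ℤ) := {(1, 0), (-1, 0), (0, 1), (0, -1)}

lemma sum_unitSteps (g : ℤ × ℤ → ℂ) :
    ∑ e ∈ unitSteps, g e = g (1, 0) + g (-1, 0) + g (0, 1) + g (0, -1) := by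
  rw [unitSteps, Finset.sum_insert (by decide), Finset.sum_insert (by decide),
    Finset.sum_insert (by decide), Finset.sum_singleton]
  ring

/-- The orbit of `s` under the random map `T`, driven by the sequence `e`. -/
def drivenOrbit {S : Type*} (T : S → ℤ × ℤ → S) (s : S) (e : ℕ → ℤ × ℤ) : ℕ → S
  | 0 => s
  | n + 1 => T (drivenOrbit T s e n) (e n)

lemma drivenOrbit_congr {S : Type*} (T : S → ℤ × ℤ → S) (s : S) {e e' : ℕ → ℤ × ℤ} {n : ℕ}
    (h : ∀ i < n, e i = e' i) : drivenOrbit T s e n = drivenOrbit T s e' n := by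
  induction n with
  | zero => rfl
  | succ n ih =>
    simp only [drivenOrbit]
    rw [ih fun i hi => h i (by omega), h n (by omega)]

lemma measurable_drivenOrbit {S α : Type*} [MeasurableSpace S] [MeasurableSpace α]
    {T : S → ℤ × ℤ → S} (hT : ∀ e, Measurable fun s => T s e) (s : S)
    {ξ : ℕ → α → ℤ × ℤ} (hξ : ∀ n, Measurable (ξ n)) (n : ℕ) :
    Measurable fun ω => drivenOrbit T s (fun i => ξ i ω) n := by
  induction n with
  | zero => exact measurable_const
  | succ n ih =>
    have h : Measurable fun q : S × (ℤ × ℤ) => T q.1 q.2 :=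
      measurable_from_prod_countable_left hT
    exact h.comp (ih.prodMk (hξ n))

variable {Ω S : Type*} [MeasurableSpace Ω] [MeasurableSpace S] {P : Measure Ω}
  {T : S → ℤ × ℤ → S} {ξ : ℕ → Ω → ℤ × ℤ}

/-- The state at time n depends only on the steps with index below n. In the proof the later steps
are replaced by 0 to express this. -/
lemma indepFun_drivenOrbit (hT : ∀ e, Measurable fun s => T s e) (s : S)
    (hξ : ∀ n, Measurable (ξ n)) (hi : iIndepFun ξ P) (n : ℕ) :
    IndepFun (fun ω => drivenOrbit T s (fun i => ξ i ω) n) (ξ n) P := by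
  have h := hi.indepFun_finset (Finset.range n) {n} (by simp) hξ
  let g : (Finset.range n → ℤ × ℤ) → S := fun x =>
    drivenOrbit T s (fun i => if hi : i ∈ Finset.range n then x ⟨i, hi⟩ else 0) n
  have hg : Measurable g := by
    refine measurable_drivenOrbit hT s (fun i => ?_) n
    by_cases hi : i ∈ Finset.range n
    · simp only [hi, dif_pos]; exact measurable_pi_apply _
    · simp only [hi, dif_neg, not_false_iff]; exact measurable_const
  have h2 := h.comp hg (measurable_pi_apply (⟨n, by simp⟩ : ({n} : Finset ℕ)))
  have h3 : (fun ω => drivenOrbit T s (fun i => ξ i ω) n) =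
      g ∘ fun ω (i : Finset.range n) => ξ i ω := by
    funext ω
    refine drivenOrbit_congr T s fun i hi => ?_
    simp [Finset.mem_range.2 hi]
  rw [h3]
  exact h2

lemma ae_mem_unitSteps [IsProbabilityMeasure P] {ζ : Ω → ℤ × ℤ} (hζ : Measurable ζ)
    (hu : ∀ e ∈ unitSteps, P {ω | ζ ω = e} = 1 / 4) : ∀ᵐ ω ∂P, ζ ω ∈ unitSteps := by
  have h : P {ω | ζ ω ∈ unitSteps} = 1 := by
    have h1 : {ω | ζ ω ∈ unitSteps} = ⋃ e ∈ unitSteps, {ω | ζ ω = e} := by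
      ext ω; simp
    rw [h1, measure_biUnion_finset, Finset.sum_congr rfl hu]
    · have : unitSteps.card = 4 := by decide
      rw [Finset.sum_const, this]
      simp only [one_div, nsmul_eq_mul, Nat.cast_ofNat]
      exact ENNReal.mul_inv_cancel (by norm_num) (by norm_num)
    · intro e _ e' _ hne
      refine Set.disjoint_left.2 fun ω h h' => hne ?_
      exact (h : ζ ω = e).symm.trans h'
    · intro e _
      exact hζ (measurableSet_singleton e)
  exact (prob_compl_eq_zero_iff (s := {ω | ζ ω ∈ unitSteps}) (hζ (Set.to_countable _).measurableSet)).2 h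

/-- One step of the Markov chain obtained by applying `T` with uniform unit steps. -/
lemma integral_drivenOrbit_succ [IsProbabilityMeasure P] (hT : ∀ e, Measurable fun s => T s e) (s : S)
    (hξ : ∀ n, Measurable (ξ n)) (hi : iIndepFun ξ P)
    (hu : ∀ n, ∀ e ∈ unitSteps, P {ω | ξ n ω = e} = 1 / 4)
    {f : S → ℂ} (hf : Measurable f) {C : ℝ} (hC : ∀ s, ‖f s‖ ≤ C) (n : ℕ) :
    ∫ ω, f (drivenOrbit T s (fun i => ξ i ω) (n + 1)) ∂P =
      ∫ ω, (1 / 4 : ℂ) * ∑ e ∈ unitSteps, f (T (drivenOrbit T s (fun i => ξ i ω) n) e) ∂P := by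
  set Y : Ω → S := fun ω => drivenOrbit T s (fun i => ξ i ω) n with hY
  have hYm : Measurable Y := measurable_drivenOrbit hT s hξ n
  have hYi : IndepFun Y (ξ n) P := indepFun_drivenOrbit hT s hξ hi n
  have hfm : ∀ e, Measurable fun ω => f (T (Y ω) e) := fun e => hf.comp ((hT e).comp hYm)
  have hfi : ∀ e, Integrable (fun ω => f (T (Y ω) e)) P := fun e =>
    Integrable.of_bound (hfm e).aestronglyMeasurable C (ae_of_all _ fun ω => hC _)
  have hind : ∀ e, Measurable fun z : ℤ × ℤ => if z = e then (1 : ℂ) else 0 := fun e =>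
    Measurable.of_discrete
  -- The step is almost surely one of the four unit vectors, so the integrand splits according to
  -- its value; independence then factors each term.
  have h1 : (fun ω => f (drivenOrbit T s (fun i => ξ i ω) (n + 1))) =ᵐ[P] fun ω =>
      ∑ e ∈ unitSteps, f (T (Y ω) e) * (if ξ n ω = e then (1 : ℂ) else 0) := by
    filter_upwards [ae_mem_unitSteps (hξ n) (hu n)] with ω hω
    simp [drivenOrbit, hY, hω]
  rw [integral_congr_ae h1, integral_finsetSum, integral_const_mul, integral_finsetSum,
    Finset.mul_sum]
  · refine Finset.sum_congr rfl fun e he => ?_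
    have h2 : IndepFun (fun ω => f (T (Y ω) e)) (fun ω => if ξ n ω = e then (1 : ℂ) else 0) P :=
      hYi.comp (φ := fun y => f (T y e)) (hf.comp (hT e)) (hind e)
    rw [h2.integral_fun_mul_eq_mul_integral (hfm e).aestronglyMeasurable
      ((hind e).comp (hξ n)).aestronglyMeasurable, mul_comm]
    congr 1
    have h3 : (fun ω => if ξ n ω = e then (1 : ℂ) else 0) =
        Set.indicator {ω | ξ n ω = e} fun _ => (1 : ℂ) := by
      funext ω; simp [Set.indicator]
    rw [h3, integral_indicator_const _ (show MeasurableSet {ω | ξ n ω = e} from hξ n (measurableSet_singleton e)), measureReal_def, hu n e he]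
    simp
  · intro e _; exact hfi e
  · intro e _
    refine Integrable.of_bound ((hfm e).mul ((hind e).comp (hξ n))).aestronglyMeasurable C
      (ae_of_all _ fun ω => ?_)
    rw [norm_mul]
    have := hC (T (Y ω) e)
    have h0 := norm_nonneg (f (T (Y ω) e))
    split_ifs
    · simpa using this
    · simp; linarith

/-- The motion of the coordinate `y - x` of a walk on `ℤ²`. -/
def antidiagonalStep (v : ℤ) (e : ℤ × ℤ) : ℤ := v + (e.2 - e.1)

/-- Each step changes y - x by +1 or -1, for two unit vectors each, and so contributes a factor cos
t. -/
lemma integral_exp_antidiagonal [IsProbabilityMeasure P] (hξ : ∀ n, Measurable (ξ n))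
    (hi : iIndepFun ξ P) (hu : ∀ n, ∀ e ∈ unitSteps, P {ω | ξ n ω = e} = 1 / 4) (t : ℝ) (n : ℕ) :
    ∫ ω, Complex.exp (Complex.I * t * (drivenOrbit antidiagonalStep 0 (fun i => ξ i ω) n : ℤ)) ∂P =
      (Real.cos t : ℂ) ^ n := by
  have hb : ∀ v : ℤ, ‖Complex.exp (Complex.I * t * v)‖ ≤ 1 := fun v => by
    rw [show Complex.I * t * v = ((t * v : ℝ) : ℂ) * Complex.I by push_cast; ring,
      Complex.norm_exp_ofReal_mul_I]
  induction n with
  | zero => simp [drivenOrbit]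
  | succ n ih =>
    rw [integral_drivenOrbit_succ (T := antidiagonalStep) (fun e => Measurable.of_discrete) 0 hξ hi hu
      (f := fun v : ℤ => Complex.exp (Complex.I * t * v)) Measurable.of_discrete hb n, pow_succ,
      ← ih, ← integral_mul_const]
    refine integral_congr_ae (ae_of_all _ fun ω => ?_)
    simp only [sum_unitSteps, antidiagonalStep]
    push_cast
    simp only [Complex.cos, mul_add, Complex.exp_add]
    simp
    rw [show Complex.I * (t : ℂ) = t * Complex.I by ring]
    ring

/-- By Fourier inversion on the circle the point mass at j is (2π)⁻¹ ∫ cos(t)^n e^{-itj} dt, and the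
integrand tends to 0 almost everywhere under the bound 1. -/
lemma tendsto_measure_antidiagonal_eq [IsProbabilityMeasure P] (hξ : ∀ n, Measurable (ξ n))
    (hi : iIndepFun ξ P) (hu : ∀ n, ∀ e ∈ unitSteps, P {ω | ξ n ω = e} = 1 / 4) (j : ℤ) :
    Tendsto (fun n => P.real {ω | drivenOrbit antidiagonalStep 0 (fun i => ξ i ω) n = j})
      atTop (nhds 0) := by
  set V : ℕ → Ω → ℤ := fun n ω => drivenOrbit antidiagonalStep 0 (fun i => ξ i ω) n with hV
  have hVm : ∀ n, Measurable (V n) := measurable_drivenOrbit (fun e => Measurable.of_discrete) 0 hξ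
  have horth : ∀ v : ℤ, ∫ t in (-Real.pi)..Real.pi, Complex.exp (Complex.I * t * v) =
      if v = 0 then (2 * Real.pi : ℂ) else 0 := by
    intro v
    split_ifs with hv
    · subst hv; simp; ring
    · have : ∀ t : ℝ, Complex.I * t * v = (Complex.I * v) * t := fun t => by ring
      simp_rw [this]
      rw [integral_exp_mul_complex (by simp [hv])]
      rw [show Complex.I * (v : ℂ) * (Real.pi : ℝ) = Complex.I * v * ((-Real.pi : ℝ) : ℂ) +
        v * (2 * Real.pi * Complex.I) by push_cast; ring, Complex.exp_add,
        Complex.exp_int_mul_two_pi_mul_I]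
      simp
  have hmeasJ : ∀ n, Measurable fun q : Ω × ℝ => Complex.exp (Complex.I * q.2 * ((V n q.1 - j : ℤ) : ℂ)) := by
    intro n
    have h1 : Measurable fun q : Ω × ℝ => (((V n q.1 - j : ℤ) : ℂ)) :=
      (Measurable.of_discrete (f := fun v : ℤ => ((v - j : ℤ) : ℂ))).comp ((hVm n).comp measurable_fst)
    fun_prop
  have hbd : ∀ (t : ℝ) (v : ℤ), ‖Complex.exp (Complex.I * t * v)‖ ≤ 1 := fun t v => by
    rw [show Complex.I * t * v = ((t * v : ℝ) : ℂ) * Complex.I by push_cast; ring,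
      Complex.norm_exp_ofReal_mul_I]
  have hkey : ∀ n, ((P.real {ω | V n ω = j} : ℝ) : ℂ) * (2 * Real.pi) =
      ∫ t in (-Real.pi)..Real.pi, (Real.cos t : ℂ) ^ n * Complex.exp (-(Complex.I * t * j)) := by
    intro n
    have h1 : ∀ t : ℝ, (Real.cos t : ℂ) ^ n * Complex.exp (-(Complex.I * t * j)) =
        ∫ ω, Complex.exp (Complex.I * t * ((V n ω - j : ℤ) : ℂ)) ∂P := by
      intro t
      rw [← integral_exp_antidiagonal hξ hi hu t n, ← integral_mul_const]
      refine integral_congr_ae (ae_of_all _ fun ω => ?_)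
      simp only [← Complex.exp_add, hV]
      push_cast
      ring_nf
    simp_rw [h1]
    rw [intervalIntegral.integral_of_le (by linarith [Real.pi_pos]), integral_integral_swap]
    · have h2 : ∀ ω, ∫ t in Set.Ioc (-Real.pi) Real.pi,
          Complex.exp (Complex.I * t * ((V n ω - j : ℤ) : ℂ)) =
          Set.indicator {ω | V n ω = j} (fun _ => (2 * Real.pi : ℂ)) ω := by
        intro ω
        rw [← intervalIntegral.integral_of_le (by linarith [Real.pi_pos]), horth]
        simp [Set.indicator, sub_eq_zero]
      simp_rw [h2]
      rw [integral_indicator_const _ (show MeasurableSet {ω | V n ω = j} from hVm n (measurableSet_singleton j))]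
      simp
    · refine Integrable.of_bound (C := 1) ?_ (ae_of_all _ fun q => hbd _ _)
      exact ((hmeasJ n).comp measurable_swap).aestronglyMeasurable
  have hlim : Tendsto (fun n : ℕ => ∫ t in (-Real.pi)..Real.pi,
      (Real.cos t : ℂ) ^ n * Complex.exp (-(Complex.I * t * j))) atTop (nhds (∫ t in (-Real.pi)..Real.pi, (0 : ℂ))) := by
    refine intervalIntegral.tendsto_integral_filter_of_dominated_convergence (fun _ => (1 : ℝ)) ?_ ?_ ?_ ?_
    · exact Eventually.of_forall fun n => (by fun_prop : Continuous _).aestronglyMeasurable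
    · refine Eventually.of_forall fun n => ae_of_all _ fun t _ => ?_
      have h3 := hbd (-t) j
      rw [norm_mul, norm_pow, Complex.norm_real, Real.norm_eq_abs]
      have h4 : Complex.exp (-(Complex.I * t * j)) = Complex.exp (Complex.I * ((-t : ℝ) : ℂ) * j) := by
        push_cast; ring_nf
      rw [h4]
      exact mul_le_one₀ (pow_le_one₀ (abs_nonneg _) (Real.abs_cos_le_one t)) (norm_nonneg _) h3
    · simp
    -- On (-π, π] these are the only two points where |cos t| = 1.
    · have h5 : ∀ᵐ t : ℝ, t ≠ 0 ∧ t ≠ Real.pi := by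
        rw [eventually_and]
        exact ⟨Measure.ae_ne _ _, Measure.ae_ne _ _⟩
      filter_upwards [h5] with t ht hmem
      rw [Set.uIoc_of_le (by linarith [Real.pi_pos])] at hmem
      have h6 : |Real.cos t| < 1 := by
        have hs : Real.sin t ≠ 0 := by
          rcases lt_or_gt_of_ne ht.1 with h | h
          · exact (Real.sin_neg_of_neg_of_neg_pi_lt h hmem.1).ne
          · exact (Real.sin_pos_of_pos_of_lt_pi h (lt_of_le_of_ne hmem.2 ht.2)).ne'
        rw [← sq_lt_one_iff_abs_lt_one]
        have := Real.sin_sq_add_cos_sq t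
        have := pow_pos (abs_pos.2 hs) 2
        rw [sq_abs] at this
        linarith
      have h7 : Tendsto (fun n : ℕ => (Real.cos t : ℂ) ^ n) atTop (nhds 0) :=
        tendsto_pow_atTop_nhds_zero_of_norm_lt_one (by rwa [Complex.norm_real])
      simpa using h7.mul_const (Complex.exp (-(Complex.I * t * j)))
  have h8 : Tendsto (fun n => ((P.real {ω | V n ω = j} : ℝ) : ℂ) * (2 * Real.pi)) atTop (nhds 0) := by
    simp_rw [hkey]
    simpa using hlim
  have h9 := (h8.mul_const ((2 * Real.pi : ℂ)⁻¹)).norm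
  have h10 : (2 * Real.pi : ℂ) ≠ 0 := by simp [Real.pi_ne_zero]
  simp only [mul_assoc, mul_inv_cancel₀ h10] at h9
  simpa [abs_of_nonneg measureReal_nonneg] using h9

/-- A walk with independent unit steps escapes from every bounded set of antidiagonals, in
probability. -/
lemma tendsto_integral_antidiagonal [IsProbabilityMeasure P] (hξ : ∀ n, Measurable (ξ n))
    (hi : iIndepFun ξ P) (hu : ∀ n, ∀ e ∈ unitSteps, P {ω | ξ n ω = e} = 1 / 4)
    {ε : ℤ → ℝ} (hε : Tendsto ε cofinite (nhds 0)) (h0 : ∀ v, 0 ≤ ε v) {C : ℝ} (hC : ∀ v, ε v ≤ C) :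
    Tendsto (fun n => ∫ ω, ε (drivenOrbit antidiagonalStep 0 (fun i => ξ i ω) n) ∂P)
      atTop (nhds 0) := by
  set V : ℕ → Ω → ℤ := fun n ω => drivenOrbit antidiagonalStep 0 (fun i => ξ i ω) n with hV
  have hVm : ∀ n, Measurable (V n) := measurable_drivenOrbit (fun e => Measurable.of_discrete) 0 hξ
  have hC0 : 0 ≤ C := (h0 0).trans (hC 0)
  rw [Metric.tendsto_atTop]
  intro η hη
  -- Outside a finite set ε is below η/2, and each of the finitely many remaining points carries
  -- vanishing mass.
  have hfin : {v : ℤ | ¬ ε v < η / 2}.Finite := by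
    have := hε.eventually (gt_mem_nhds (half_pos hη))
    exact this
  set A := hfin.toFinset with hA
  have hle : ∀ n, ∫ ω, ε (V n ω) ∂P ≤ η / 2 + C * ∑ j ∈ A, P.real {ω | V n ω = j} := by
    intro n
    have h1 : ∀ ω, ε (V n ω) ≤ η / 2 + C * ∑ j ∈ A, Set.indicator {ω | V n ω = j} (fun _ => (1 : ℝ)) ω := by
      intro ω
      by_cases hv : V n ω ∈ A
      · have : ∑ j ∈ A, Set.indicator {ω | V n ω = j} (fun _ => (1 : ℝ)) ω = 1 := by
          simp [Set.indicator, hv]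
        rw [this]
        linarith [hC (V n ω)]
      · have h2 : ε (V n ω) < η / 2 := by simpa [hA] using hv
        have h3 : 0 ≤ ∑ j ∈ A, Set.indicator {ω | V n ω = j} (fun _ => (1 : ℝ)) ω :=
          Finset.sum_nonneg fun j _ => Set.indicator_nonneg (fun _ _ => zero_le_one) _
        nlinarith
    have hmj : ∀ j, MeasurableSet {ω | V n ω = j} := fun j => hVm n (measurableSet_singleton j)
    have hint : ∀ j ∈ A, Integrable (Set.indicator {ω | V n ω = j} (fun _ => (1 : ℝ))) P := fun j _ =>
      (integrable_const 1).indicator (hmj j)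
    calc ∫ ω, ε (V n ω) ∂P ≤ ∫ ω, (η / 2 + C * ∑ j ∈ A, Set.indicator {ω | V n ω = j} (fun _ => (1 : ℝ)) ω) ∂P := by
          refine integral_mono ?_ ?_ h1
          · refine Integrable.of_bound (C := C) ((Measurable.of_discrete (f := ε)).comp (hVm n)).aestronglyMeasurable
              (ae_of_all _ fun ω => ?_)
            rw [Real.norm_eq_abs, abs_of_nonneg (h0 _)]; exact hC _
          · exact (integrable_const _).add ((integrable_finsetSum _ hint).const_mul C)
      _ = _ := by
          rw [integral_add (integrable_const _) ((integrable_finsetSum _ hint).const_mul C),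
            integral_const_mul, integral_finsetSum _ hint]
          simp only [integral_const, probReal_univ, smul_eq_mul, one_mul]
          congr 2
          refine Finset.sum_congr rfl fun j _ => ?_
          rw [integral_indicator_const _ (hmj j)]; simp
  have hsum : Tendsto (fun n => C * ∑ j ∈ A, P.real {ω | V n ω = j}) atTop (nhds 0) := by
    have := (tendsto_finsetSum A fun j _ => tendsto_measure_antidiagonal_eq hξ hi hu j).const_mul C
    simpa using this
  obtain ⟨N, hN⟩ := (eventually_atTop.1 (hsum.eventually (gt_mem_nhds (half_pos hη))))
  refine ⟨N, fun n hn => ?_⟩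
  rw [Real.dist_eq, sub_zero, abs_of_nonneg (integral_nonneg fun ω => h0 _)]
  linarith [hle n, hN n hn]

end MarkovChain

/-! ### The half-plane kernel: beta integrals, harmonicity and boundary values. -/

section SlitPlaneKernel

lemma integrableOn_beta {p q : ℝ} (hp : 0 < p) (hq : 0 < q) :
    IntegrableOn (fun x : ℝ => x ^ (p - 1) * (1 - x) ^ (q - 1)) (Set.Ioo 0 1) := by
  have h := Complex.betaIntegral_convergent (u := p) (v := q) (by simpa) (by simpa)
  rw [intervalIntegrable_iff_integrableOn_Ioo_of_le zero_le_one] at h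
  refine h.re.congr ?_
  filter_upwards [ae_restrict_mem measurableSet_Ioo] with x hx
  rw [show (1 : ℂ) - (x : ℂ) = ((1 - x : ℝ) : ℂ) by push_cast; rfl,
    show (p : ℂ) - 1 = ((p - 1 : ℝ) : ℂ) by push_cast; rfl,
    show (q : ℂ) - 1 = ((q - 1 : ℝ) : ℂ) by push_cast; rfl,
    ← Complex.ofReal_cpow hx.1.le, ← Complex.ofReal_cpow (by linarith [hx.2]), ← Complex.ofReal_mul]
  simp

lemma integral_beta {p q : ℝ} (hp : 0 < p) (hq : 0 < q) :
    ∫ x in Set.Ioo (0 : ℝ) 1, x ^ (p - 1) * (1 - x) ^ (q - 1) = beta p q := by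
  rw [beta_eq_betaIntegralReal p q hp hq, Complex.betaIntegral,
    intervalIntegral.integral_of_le zero_le_one, integral_Ioc_eq_integral_Ioo]
  rw [← Complex.ofReal_re (∫ x in Set.Ioo (0 : ℝ) 1, x ^ (p - 1) * (1 - x) ^ (q - 1)),
    ← integral_complex_ofReal]
  congr 1
  refine setIntegral_congr_fun measurableSet_Ioo fun x hx => ?_
  rw [show (1 : ℂ) - (x : ℂ) = ((1 - x : ℝ) : ℂ) by push_cast; rfl,
    show (p : ℂ) - 1 = ((p - 1 : ℝ) : ℂ) by push_cast; rfl,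
    show (q : ℂ) - 1 = ((q - 1 : ℝ) : ℂ) by push_cast; rfl,
    ← Complex.ofReal_cpow hx.1.le, ← Complex.ofReal_cpow (by linarith [hx.2]), ← Complex.ofReal_mul]

lemma sin_half_pos {φ : ℝ} (h : φ ∈ Set.Ioo 0 Real.pi) : 0 < Real.sin (φ / 2) :=
  Real.sin_pos_of_pos_of_lt_pi (by linarith [h.1]) (by linarith [h.2, Real.pi_pos])

lemma cos_half_pos {φ : ℝ} (h : φ ∈ Set.Ioo 0 Real.pi) : 0 < Real.cos (φ / 2) :=
  Real.cos_pos_of_mem_Ioo ⟨by linarith [h.1, Real.pi_pos], by linarith [h.2]⟩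

lemma hasDerivAt_sin_half_sq (φ : ℝ) :
    HasDerivAt (fun φ : ℝ => Real.sin (φ / 2) ^ 2) (Real.sin (φ / 2) * Real.cos (φ / 2)) φ := by
  have h := (((hasDerivAt_id φ).div_const 2).sin).pow 2
  refine h.congr_deriv ?_
  simp; ring

lemma image_sin_half_sq :
    (fun φ : ℝ => Real.sin (φ / 2) ^ 2) '' Set.Ioo 0 Real.pi = Set.Ioo 0 1 := by
  ext x
  constructor
  · rintro ⟨φ, hφ, rfl⟩
    have h1 := sin_half_pos hφ
    have h2 := cos_half_pos hφ
    have h3 := Real.sin_sq_add_cos_sq (φ / 2)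
    constructor <;> dsimp only
    · positivity
    · nlinarith [pow_pos h2 2]
  · intro hx
    have h0 : 0 < √x := Real.sqrt_pos.2 hx.1
    have h1 : √x < 1 := by rw [Real.sqrt_lt' one_pos]; simpa using hx.2
    refine ⟨2 * Real.arcsin √x, ⟨by have := Real.arcsin_pos.2 h0; linarith, ?_⟩, ?_⟩
    · have := Real.arcsin_lt_pi_div_two.2 h1; linarith
    · dsimp only
      rw [mul_div_cancel_left₀ _ two_ne_zero, Real.sin_arcsin (by linarith) h1.le,
        Real.sq_sqrt hx.1.le]

lemma injOn_sin_half_sq :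
    Set.InjOn (fun φ : ℝ => Real.sin (φ / 2) ^ 2) (Set.Ioo 0 Real.pi) := by
  intro φ hφ ψ hψ h
  have h1 : Real.sin (φ / 2) = Real.sin (ψ / 2) :=
    (pow_left_inj₀ (sin_half_pos hφ).le (sin_half_pos hψ).le two_ne_zero).1 h
  have := Real.injOn_sin ⟨by linarith [hφ.1, Real.pi_pos], by linarith [hφ.2]⟩
    ⟨by linarith [hψ.1, Real.pi_pos], by linarith [hψ.2]⟩ h1
  linarith

/-- With x = sin²(φ/2) one has dx = sin(φ/2) cos(φ/2) dφ, which raises the exponents 2p - 2 and 2q -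
2 by one. This carries Euler's beta integral over to (0, π). -/
lemma beta_integrand_comp_sin_half_sq (p q : ℝ) {φ : ℝ} (hφ : φ ∈ Set.Ioo 0 Real.pi) :
    |Real.sin (φ / 2) * Real.cos (φ / 2)| •
      ((Real.sin (φ / 2) ^ 2) ^ (p - 1) * (1 - Real.sin (φ / 2) ^ 2) ^ (q - 1)) =
      Real.sin (φ / 2) ^ (2 * p - 1) * Real.cos (φ / 2) ^ (2 * q - 1) := by
  have h1 := sin_half_pos hφ
  have h2 := cos_half_pos hφ
  rw [show 1 - Real.sin (φ / 2) ^ 2 = Real.cos (φ / 2) ^ 2 by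
    linarith [Real.sin_sq_add_cos_sq (φ / 2)], abs_of_pos (mul_pos h1 h2), smul_eq_mul,
    ← Real.rpow_natCast_mul h1.le, ← Real.rpow_natCast_mul h2.le,
    show 2 * p - 1 = 1 + ((2 : ℕ) : ℝ) * (p - 1) by push_cast; ring,
    show 2 * q - 1 = 1 + ((2 : ℕ) : ℝ) * (q - 1) by push_cast; ring,
    Real.rpow_add h1, Real.rpow_add h2, Real.rpow_one, Real.rpow_one]
  ring

lemma integrableOn_sin_rpow_mul_cos_rpow {p q : ℝ} (hp : 0 < p) (hq : 0 < q) :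
    IntegrableOn (fun φ => Real.sin (φ / 2) ^ (2 * p - 1) * Real.cos (φ / 2) ^ (2 * q - 1))
      (Set.Ioo 0 Real.pi) := by
  have h := integrableOn_beta hp hq
  rw [← image_sin_half_sq, integrableOn_image_iff_integrableOn_abs_deriv_smul measurableSet_Ioo
    (fun φ _ => (hasDerivAt_sin_half_sq φ).hasDerivWithinAt) injOn_sin_half_sq] at h
  exact h.congr_fun (fun φ hφ => beta_integrand_comp_sin_half_sq p q hφ) measurableSet_Ioo

lemma integral_sin_rpow_mul_cos_rpow {p q : ℝ} (hp : 0 < p) (hq : 0 < q) :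
    ∫ φ in (0)..Real.pi, Real.sin (φ / 2) ^ (2 * p - 1) * Real.cos (φ / 2) ^ (2 * q - 1) =
      beta p q := by
  rw [intervalIntegral.integral_of_le Real.pi_pos.le, integral_Ioc_eq_integral_Ioo,
    ← integral_beta hp hq, ← image_sin_half_sq, integral_image_eq_integral_abs_deriv_smul
      measurableSet_Ioo (fun φ _ => (hasDerivAt_sin_half_sq φ).hasDerivWithinAt) injOn_sin_half_sq]
  exact setIntegral_congr_fun measurableSet_Ioo
    fun φ hφ => (beta_integrand_comp_sin_half_sq p q hφ).symm

/-- The weight `cot (φ / 2) ^ a`. -/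
noncomputable def cotWeight (a φ : ℝ) : ℝ := Real.sin (φ / 2) ^ (-a) * Real.cos (φ / 2) ^ a

/-- The decay rate of the discrete harmonic exponential of frequency `φ`. -/
noncomputable def decayRate (φ : ℝ) : ℝ := Real.cos φ / (1 + Real.sin φ)

/-- A discrete harmonic function on the half plane `v ≥ 0`, in diagonal coordinates. -/
noncomputable def halfPlaneKernel (a : ℝ) (u : ℤ) (v : ℕ) : ℂ :=
  ∫ φ in (0)..Real.pi,
    (cotWeight a φ : ℂ) * ((decayRate φ : ℂ) ^ v * Complex.exp (-(Complex.I * u * φ)))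

variable {a : ℝ}

lemma intervalIntegrable_cotWeight (h0 : 0 ≤ a) (h1 : a < 1) :
    IntervalIntegrable (cotWeight a) volume 0 Real.pi := by
  rw [intervalIntegrable_iff_integrableOn_Ioo_of_le Real.pi_pos.le]
  have h := integrableOn_sin_rpow_mul_cos_rpow (p := (1 - a) / 2) (q := (1 + a) / 2)
    (by linarith) (by linarith)
  refine h.congr_fun (fun φ _ => ?_) measurableSet_Ioo
  simp only [cotWeight]
  congr 2 <;> ring

/-- The two beta parameters add up to 1, so the reflection formula for Γ evaluates the integral. -/
lemma integral_cotWeight (h0 : 0 ≤ a) (h1 : a < 1) :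
    ∫ φ in (0)..Real.pi, cotWeight a φ = Real.pi / Real.cos (Real.pi * a / 2) := by
  have h := integral_sin_rpow_mul_cos_rpow (p := (1 - a) / 2) (q := (1 + a) / 2)
    (by linarith) (by linarith)
  have h2 := Real.Gamma_mul_Gamma_one_sub ((1 + a) / 2)
  rw [show 1 - (1 + a) / 2 = (1 - a) / 2 by ring,
    show Real.pi * ((1 + a) / 2) = Real.pi * a / 2 + Real.pi / 2 by ring,
    Real.sin_add_pi_div_two] at h2
  rw [beta, show (1 - a) / 2 + (1 + a) / 2 = 1 by ring, Real.Gamma_one, div_one,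
    mul_comm (Real.Gamma ((1 - a) / 2)), h2] at h
  rw [← h]
  congr 1
  funext φ
  unfold cotWeight
  congr 2 <;> ring

lemma cotWeight_nonneg {φ : ℝ} (h : φ ∈ Set.Icc 0 Real.pi) : 0 ≤ cotWeight a φ :=
  mul_nonneg
    (Real.rpow_nonneg (Real.sin_nonneg_of_nonneg_of_le_pi (by linarith [h.1])
      (by linarith [h.2, Real.pi_pos])) _)
    (Real.rpow_nonneg (Real.cos_nonneg_of_mem_Icc
      ⟨by linarith [h.1, Real.pi_pos], by linarith [h.2]⟩) _)

lemma one_add_sin_pos {φ : ℝ} (h : φ ∈ Set.Icc 0 Real.pi) : 0 < 1 + Real.sin φ := by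
  linarith [Real.sin_nonneg_of_nonneg_of_le_pi h.1 h.2]

/-- This is the condition for λ^v e^{-iuφ} to be harmonic for the four diagonal neighbours. Of the
roots (1 ± sin φ)/cos φ the bounded one is used, in a form that is regular at φ = π/2. -/
lemma decayRate_identity {φ : ℝ} (h : φ ∈ Set.Icc 0 Real.pi) :
    (decayRate φ ^ 2 + 1) * Real.cos φ = 2 * decayRate φ := by
  have h1 := one_add_sin_pos h
  unfold decayRate
  field_simp
  linear_combination Real.cos φ * Real.sin_sq_add_cos_sq φ

/-- This identity expresses the row v = 1 through boundary values alone: 1 gives the value itself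
and sin φ a difference along the boundary. -/
lemma decayRate_mul_cos {φ : ℝ} (h : φ ∈ Set.Icc 0 Real.pi) :
    decayRate φ * Real.cos φ = 1 - Real.sin φ := by
  have h1 := one_add_sin_pos h
  unfold decayRate
  field_simp
  nlinarith [Real.sin_sq_add_cos_sq φ]

lemma abs_decayRate_lt_one {φ : ℝ} (h : φ ∈ Set.Ioo 0 Real.pi) : |decayRate φ| < 1 := by
  have hs := Real.sin_pos_of_pos_of_lt_pi h.1 h.2
  unfold decayRate
  rw [abs_div, abs_of_pos (by linarith : 0 < 1 + Real.sin φ), div_lt_one (by linarith)]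
  linarith [Real.abs_cos_le_one φ]

lemma continuousOn_decayRate : ContinuousOn decayRate (Set.Icc 0 Real.pi) :=
  Real.continuous_cos.continuousOn.div (by fun_prop) fun _ h => (one_add_sin_pos h).ne'

lemma intervalIntegrable_cotWeight_mul (h0 : 0 ≤ a) (h1 : a < 1) {g : ℝ → ℂ}
    (hg : ContinuousOn g (Set.Icc 0 Real.pi)) :
    IntervalIntegrable (fun φ => (cotWeight a φ : ℂ) * g φ) volume 0 Real.pi := by
  refine IntervalIntegrable.mul_continuousOn ?_ (by rwa [Set.uIcc_of_le Real.pi_pos.le])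
  have h := intervalIntegrable_cotWeight h0 h1
  exact ⟨h.1.ofReal, h.2.ofReal⟩

lemma intervalIntegrable_halfPlaneKernel (h0 : 0 ≤ a) (h1 : a < 1) (u : ℤ) (v : ℕ) :
    IntervalIntegrable (fun φ : ℝ => (cotWeight a φ : ℂ) *
      ((decayRate φ : ℂ) ^ v * Complex.exp (-(Complex.I * u * φ)))) volume 0 Real.pi := by
  refine intervalIntegrable_cotWeight_mul h0 h1 (ContinuousOn.mul (ContinuousOn.pow ?_ v) (by fun_prop))
  exact Complex.continuous_ofReal.comp_continuousOn continuousOn_decayRate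

lemma norm_exp_neg_I_mul (u : ℤ) (φ : ℝ) : ‖Complex.exp (-(Complex.I * u * φ))‖ = 1 := by
  rw [show -(Complex.I * u * φ) = ((-(u * φ) : ℝ) : ℂ) * Complex.I by push_cast; ring,
    Complex.norm_exp_ofReal_mul_I]

/-- The decay of `halfPlaneKernel` with the distance to the boundary. -/
noncomputable def kernelBound (a : ℝ) (v : ℕ) : ℝ :=
  ∫ φ in (0)..Real.pi, cotWeight a φ * |decayRate φ| ^ v

lemma norm_halfPlaneKernel_le (h0 : 0 ≤ a) (h1 : a < 1) (u : ℤ) (v : ℕ) :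
    ‖halfPlaneKernel a u v‖ ≤ kernelBound a v := by
  refine intervalIntegral.norm_integral_le_of_norm_le Real.pi_pos.le ?_ ?_
  · refine ae_of_all _ fun φ hφ => ?_
    rw [norm_mul, norm_mul, norm_exp_neg_I_mul, norm_pow, mul_one, Complex.norm_real,
      Complex.norm_real, Real.norm_eq_abs, Real.norm_eq_abs,
      abs_of_nonneg (cotWeight_nonneg ⟨hφ.1.le, hφ.2⟩)]
  · refine (intervalIntegrable_cotWeight h0 h1).mul_continuousOn ?_
    rw [Set.uIcc_of_le Real.pi_pos.le]
    exact continuousOn_decayRate.abs.pow v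

lemma kernelBound_nonneg (v : ℕ) : 0 ≤ kernelBound a v :=
  intervalIntegral.integral_nonneg Real.pi_pos.le fun φ hφ =>
    mul_nonneg (cotWeight_nonneg hφ) (by positivity)

lemma abs_decayRate_le_one {φ : ℝ} (h : φ ∈ Set.Icc 0 Real.pi) : |decayRate φ| ≤ 1 := by
  have hs := Real.sin_nonneg_of_nonneg_of_le_pi h.1 h.2
  unfold decayRate
  rw [abs_div, abs_of_pos (by linarith : 0 < 1 + Real.sin φ), div_le_one (by linarith)]
  linarith [Real.abs_cos_le_one φ]

lemma kernelBound_le (h0 : 0 ≤ a) (h1 : a < 1) (v : ℕ) : kernelBound a v ≤ kernelBound a 0 := by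
  have hint : ∀ v : ℕ, IntervalIntegrable (fun φ => cotWeight a φ * |decayRate φ| ^ v) volume 0 Real.pi := by
    intro v
    refine (intervalIntegrable_cotWeight h0 h1).mul_continuousOn ?_
    rw [Set.uIcc_of_le Real.pi_pos.le]
    exact continuousOn_decayRate.abs.pow v
  refine intervalIntegral.integral_mono_on Real.pi_pos.le (hint v) (hint 0) fun φ hφ => ?_
  exact mul_le_mul_of_nonneg_left
    (by simpa using pow_le_one₀ (abs_nonneg _) (abs_decayRate_le_one hφ)) (cotWeight_nonneg hφ)

/-- Since |λ| < 1 inside the interval, dominated convergence applies with the integrable weight as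
majorant. -/
lemma tendsto_kernelBound (h0 : 0 ≤ a) (h1 : a < 1) :
    Tendsto (kernelBound a) atTop (nhds 0) := by
  have h := intervalIntegral.tendsto_integral_filter_of_dominated_convergence (μ := volume)
    (a := 0) (b := Real.pi) (F := fun (v : ℕ) φ => cotWeight a φ * |decayRate φ| ^ v)
    (f := fun _ => 0) (l := atTop) (cotWeight a) ?_ ?_ (intervalIntegrable_cotWeight h0 h1) ?_
  · rw [intervalIntegral.integral_zero] at h
    exact h
  · refine Eventually.of_forall fun v => ?_
    rw [Set.uIoc_of_le Real.pi_pos.le]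
    refine IntervalIntegrable.aestronglyMeasurable ?_
    refine (intervalIntegrable_cotWeight h0 h1).mul_continuousOn ?_
    rw [Set.uIcc_of_le Real.pi_pos.le]
    exact continuousOn_decayRate.abs.pow v
  · refine Eventually.of_forall fun v => ae_of_all _ fun φ hφ => ?_
    rw [Set.uIoc_of_le Real.pi_pos.le] at hφ
    have hφ' : φ ∈ Set.Icc 0 Real.pi := ⟨hφ.1.le, hφ.2⟩
    rw [Real.norm_eq_abs, abs_of_nonneg (mul_nonneg (cotWeight_nonneg hφ') (by positivity))]
    exact mul_le_of_le_one_right (cotWeight_nonneg hφ')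
      (pow_le_one₀ (abs_nonneg _) (abs_decayRate_le_one hφ'))
  · filter_upwards [Measure.ae_ne volume Real.pi] with φ hne hφ
    rw [Set.uIoc_of_le Real.pi_pos.le] at hφ
    have := tendsto_pow_atTop_nhds_zero_of_lt_one (abs_nonneg _)
      (abs_decayRate_lt_one ⟨hφ.1, lt_of_le_of_ne hφ.2 hne⟩)
    simpa using this.const_mul (cotWeight a φ)

lemma halfPlaneKernel_neg (u : ℤ) (v : ℕ) :
    halfPlaneKernel a (-u) v = (starRingEnd ℂ) (halfPlaneKernel a u v) := by
  unfold halfPlaneKernel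
  rw [intervalIntegral.integral_of_le Real.pi_pos.le, intervalIntegral.integral_of_le Real.pi_pos.le,
    ← integral_conj]
  congr 1
  funext φ
  simp only [map_mul, map_pow, Complex.conj_ofReal, ← Complex.exp_conj, map_neg, Complex.conj_I,
    map_intCast]
  push_cast
  ring_nf

lemma halfPlaneKernel_zero_zero (h0 : 0 ≤ a) (h1 : a < 1) :
    halfPlaneKernel a 0 0 = ((Real.pi / Real.cos (Real.pi * a / 2) : ℝ) : ℂ) := by
  rw [← integral_cotWeight h0 h1, ← intervalIntegral.integral_ofReal]
  simp [halfPlaneKernel]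

lemma exp_shift (u : ℤ) (φ : ℝ) :
    Complex.exp (-(Complex.I * ((u + 1 : ℤ) : ℂ) * φ)) =
        (Real.cos φ - Real.sin φ * Complex.I) * Complex.exp (-(Complex.I * u * φ)) ∧
    Complex.exp (-(Complex.I * ((u - 1 : ℤ) : ℂ) * φ)) =
        (Real.cos φ + Real.sin φ * Complex.I) * Complex.exp (-(Complex.I * u * φ)) := by
  constructor
  · rw [show -(Complex.I * ((u + 1 : ℤ) : ℂ) * φ) = ((-φ : ℝ) : ℂ) * Complex.I + -(Complex.I * u * φ) by
      push_cast; ring, Complex.exp_add, Complex.exp_mul_I, ← Complex.ofReal_cos, ← Complex.ofReal_sin,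
      Real.cos_neg, Real.sin_neg]
    push_cast; ring
  · rw [show -(Complex.I * ((u - 1 : ℤ) : ℂ) * φ) = (φ : ℂ) * Complex.I + -(Complex.I * u * φ) by
      push_cast; ring, Complex.exp_add, Complex.exp_mul_I, ← Complex.ofReal_cos, ← Complex.ofReal_sin]

/-- `halfPlaneKernel` is discrete harmonic in the open half plane. -/
lemma halfPlaneKernel_harmonic (h0 : 0 ≤ a) (h1 : a < 1) (u : ℤ) (v : ℕ) :
    halfPlaneKernel a (u + 1) (v + 2) + halfPlaneKernel a (u - 1) (v + 2) +
      halfPlaneKernel a (u + 1) v + halfPlaneKernel a (u - 1) v =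
      4 * halfPlaneKernel a u (v + 1) := by
  have hi := intervalIntegrable_halfPlaneKernel h0 h1
  unfold halfPlaneKernel
  rw [← intervalIntegral.integral_add (hi _ _) (hi _ _),
    ← intervalIntegral.integral_add ((hi _ _).add (hi _ _)) (hi _ _),
    ← intervalIntegral.integral_add (((hi _ _).add (hi _ _)).add (hi _ _)) (hi _ _),
    ← intervalIntegral.integral_const_mul]
  refine intervalIntegral.integral_congr fun φ hφ => ?_
  rw [Set.uIcc_of_le Real.pi_pos.le] at hφ
  have h := congrArg (fun x : ℝ => (x : ℂ)) (decayRate_identity hφ)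
  push_cast at h
  rw [(exp_shift u φ).1, (exp_shift u φ).2]
  push_cast
  linear_combination (2 * (cotWeight a φ : ℂ) * (decayRate φ : ℂ) ^ v *
    Complex.exp (-(Complex.I * u * φ))) * h

/-- The values of `halfPlaneKernel` next to the boundary, in terms of its boundary values. -/
lemma halfPlaneKernel_boundary (h0 : 0 ≤ a) (h1 : a < 1) (u : ℤ) :
    halfPlaneKernel a (u + 1) 1 + halfPlaneKernel a (u - 1) 1 =
      2 * halfPlaneKernel a u 0 +
        Complex.I * (halfPlaneKernel a (u - 1) 0 - halfPlaneKernel a (u + 1) 0) := by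
  have hi := intervalIntegrable_halfPlaneKernel h0 h1
  unfold halfPlaneKernel
  rw [← intervalIntegral.integral_add (hi _ _) (hi _ _),
    ← intervalIntegral.integral_sub (hi _ _) (hi _ _),
    ← intervalIntegral.integral_const_mul, ← intervalIntegral.integral_const_mul,
    ← intervalIntegral.integral_add ((hi _ _).const_mul 2) (((hi _ _).sub (hi _ _)).const_mul _)]
  refine intervalIntegral.integral_congr fun φ hφ => ?_
  rw [Set.uIcc_of_le Real.pi_pos.le] at hφ
  have h := congrArg (fun x : ℝ => (x : ℂ)) (decayRate_mul_cos hφ)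
  push_cast at h
  rw [(exp_shift u φ).1, (exp_shift u φ).2]
  push_cast
  linear_combination (2 * (cotWeight a φ : ℂ) * Complex.exp (-(Complex.I * u * φ))) * h -
    2 * (cotWeight a φ : ℂ) * Complex.exp (-(Complex.I * u * φ)) * Complex.sin φ * Complex.I_sq

/-- The factor sin φ makes both exponents positive, so this product vanishes at 0 and π and an
integration by parts leaves no boundary terms. -/
lemma cotWeight_mul_sin {φ : ℝ} (h : φ ∈ Set.Ioo 0 Real.pi) :
    cotWeight a φ * Real.sin φ = 2 * (Real.sin (φ / 2) ^ (1 - a) * Real.cos (φ / 2) ^ (1 + a)) := by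
  have hs := sin_half_pos h
  have hc := cos_half_pos h
  rw [show 1 - a = -a + 1 by ring, show 1 + a = a + 1 by ring, Real.rpow_add hs, Real.rpow_add hc,
    cotWeight, Real.rpow_one, Real.rpow_one]
  have := Real.sin_two_mul (φ / 2)
  rw [mul_div_cancel₀ _ (two_ne_zero' ℝ)] at this
  rw [this]
  ring

/-- The weight w satisfies (w sin)' = (cos - a) w. This first-order equation is the source of the
recurrence of the Fourier coefficients. -/
lemma hasDerivAt_sin_rpow_mul_cos_rpow {φ : ℝ} (h : φ ∈ Set.Ioo 0 Real.pi) :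
    HasDerivAt (fun φ => 2 * (Real.sin (φ / 2) ^ (1 - a) * Real.cos (φ / 2) ^ (1 + a)))
      ((Real.cos φ - a) * cotWeight a φ) φ := by
  have hs := sin_half_pos h
  have hc := cos_half_pos h
  have h1 := (((hasDerivAt_id φ).div_const 2).sin).rpow_const (p := 1 - a) (Or.inl hs.ne')
  have h2 := (((hasDerivAt_id φ).div_const 2).cos).rpow_const (p := 1 + a) (Or.inl hc.ne')
  refine ((h1.mul h2).const_mul 2).congr_deriv ?_
  simp only [id]
  rw [show 1 - a - 1 = -a by ring, show 1 + a - 1 = a by ring, show 1 - a = -a + 1 by ring,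
    show 1 + a = a + 1 by ring, Real.rpow_add hs, Real.rpow_add hc, cotWeight, Real.rpow_one,
    Real.rpow_one]
  have h3 := Real.cos_sq' (φ / 2)
  have h4 : Real.cos φ = 2 * Real.cos (φ / 2) ^ 2 - 1 := by
    rw [← Real.cos_two_mul]; congr 1; ring
  rw [h4]
  linear_combination (-(1 + a) * Real.sin (φ / 2) ^ (-a) * Real.cos (φ / 2) ^ a) * h3

/-- The three-term recurrence of the boundary values. -/
lemma halfPlaneKernel_recurrence (h0 : 0 ≤ a) (h1 : a < 1) (n : ℤ) :
    (n + 1) * halfPlaneKernel a (n + 1) 0 - (n - 1) * halfPlaneKernel a (n - 1) 0 =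
      2 * a * halfPlaneKernel a n 0 := by
  set K : ℝ → ℂ := fun φ =>
    ((2 * (Real.sin (φ / 2) ^ (1 - a) * Real.cos (φ / 2) ^ (1 + a)) : ℝ) : ℂ) *
      Complex.exp (-(Complex.I * n * φ)) with hK
  have hcont : ContinuousOn K (Set.Icc 0 Real.pi) := by
    refine ContinuousOn.mul ?_ (by fun_prop)
    refine Continuous.continuousOn (Complex.continuous_ofReal.comp ?_)
    refine continuous_const.mul (Continuous.mul ?_ ?_)
    · exact (by fun_prop : Continuous fun φ : ℝ => Real.sin (φ / 2)).rpow_const fun _ => Or.inr (by linarith)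
    · exact (by fun_prop : Continuous fun φ : ℝ => Real.cos (φ / 2)).rpow_const fun _ => Or.inr (by linarith)
  have hderiv : ∀ φ ∈ Set.Ioo 0 Real.pi, HasDerivAt K ((cotWeight a φ : ℂ) *
      (((Real.cos φ - a : ℝ) - Complex.I * n * Real.sin φ) * Complex.exp (-(Complex.I * n * φ)))) φ := by
    intro φ hφ
    have hd1 := (hasDerivAt_sin_rpow_mul_cos_rpow (a := a) hφ).ofReal_comp
    have hd2 : HasDerivAt (fun φ : ℝ => Complex.exp (-(Complex.I * n * φ)))
        (Complex.exp (-(Complex.I * n * φ)) * -(Complex.I * n)) φ := by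
      refine HasDerivAt.cexp ?_
      have := ((Complex.ofRealCLM.hasDerivAt (x := φ)).const_mul (Complex.I * n)).neg
      exact this.congr_deriv (by simp)
    refine (hd1.mul hd2).congr_deriv ?_
    rw [← cotWeight_mul_sin hφ]
    push_cast
    ring
  have hint := intervalIntegrable_cotWeight_mul h0 h1 (g := fun φ : ℝ =>
    (((Real.cos φ - a : ℝ) - Complex.I * n * Real.sin φ) * Complex.exp (-(Complex.I * n * φ))))
    (by fun_prop)
  have hftc := intervalIntegral.integral_eq_sub_of_hasDerivAt_of_le Real.pi_pos.le hcont hderiv hint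
  have hz : K Real.pi - K 0 = 0 := by
    simp [hK, Real.zero_rpow (by linarith : (1 - a) ≠ 0), Real.zero_rpow (by linarith : (1 + a) ≠ 0)]
  rw [hz] at hftc
  have hi := intervalIntegrable_halfPlaneKernel h0 h1
  unfold halfPlaneKernel
  rw [← intervalIntegral.integral_const_mul, ← intervalIntegral.integral_const_mul,
    ← intervalIntegral.integral_const_mul,
    ← intervalIntegral.integral_sub ((hi _ _).const_mul _) ((hi _ _).const_mul _),
    ← sub_eq_zero, ← intervalIntegral.integral_sub (((hi _ _).const_mul _).sub ((hi _ _).const_mul _))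
      ((hi _ _).const_mul _)]
  have h2 : (2 : ℂ) * 0 = 0 := mul_zero 2
  rw [← h2, ← hftc, ← intervalIntegral.integral_const_mul]
  refine intervalIntegral.integral_congr fun φ hφ => ?_
  rw [(exp_shift n φ).1, (exp_shift n φ).2]
  push_cast
  ring

/-- The moduli of the boundary values of `halfPlaneKernel`. -/
noncomputable def boundarySeq (a : ℝ) : ℕ → ℝ
  | 0 => 0
  | 1 => 2 * beta (1 - a / 2) (1 + a / 2) / Real.cos (Real.pi * a / 2)
  | n + 2 => (2 * a * boundarySeq a (n + 1) + n * boundarySeq a n) / (n + 2)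

lemma cos_pi_mul_half_pos (h0 : 0 ≤ a) (h1 : a < 1) : 0 < Real.cos (Real.pi * a / 2) :=
  Real.cos_pos_of_mem_Ioo ⟨by nlinarith [Real.pi_pos], by nlinarith [Real.pi_pos]⟩

/-- The reflection formula at a/2 together with Γ(1 + a/2) = (a/2) Γ(a/2). It fixes the ratio of the
real and imaginary parts of the first boundary value, hence its phase. -/
lemma beta_mul_sin (h0 : 0 ≤ a) (h1 : a < 1) :
    2 * beta (1 - a / 2) (1 + a / 2) * Real.sin (Real.pi * a / 2) = a * Real.pi := by
  rcases h0.eq_or_lt with rfl | h0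
  · simp
  · have h2 : Real.sin (Real.pi * a / 2) ≠ 0 :=
      (Real.sin_pos_of_pos_of_lt_pi (by positivity) (by nlinarith [Real.pi_pos])).ne'
    have h3 := Real.Gamma_mul_Gamma_one_sub (a / 2)
    rw [show Real.pi * (a / 2) = Real.pi * a / 2 by ring] at h3
    rw [beta, show 1 - a / 2 + (1 + a / 2) = 2 by ring, Real.Gamma_two, add_comm 1 (a / 2),
      Real.Gamma_add_one (by positivity), div_one]
    rw [eq_div_iff h2] at h3
    linear_combination a * h3

/-- The recurrence at n = 0 gives the sum of the values at ±1, which is twice the real part; their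
difference is a beta integral and gives the imaginary part. -/
lemma halfPlaneKernel_one (h0 : 0 ≤ a) (h1 : a < 1) :
    halfPlaneKernel a 1 0 =
      -Complex.I * Complex.exp (Complex.I * (Real.pi * a / 2 : ℝ)) * boundarySeq a 1 := by
  have hc := (cos_pi_mul_half_pos h0 h1).ne'
  have hi := intervalIntegrable_halfPlaneKernel h0 h1
  have hre : halfPlaneKernel a 1 0 + halfPlaneKernel a (-1) 0 =
      ((2 * a * (Real.pi / Real.cos (Real.pi * a / 2)) : ℝ) : ℂ) := by
    have := halfPlaneKernel_recurrence h0 h1 0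
    rw [halfPlaneKernel_zero_zero h0 h1] at this
    push_cast at this ⊢
    rw [zero_add, zero_sub] at this
    linear_combination this
  have him : halfPlaneKernel a 1 0 - halfPlaneKernel a (-1) 0 =
      -2 * Complex.I * ((2 * beta (1 - a / 2) (1 + a / 2) : ℝ) : ℂ) := by
    have hb := integral_sin_rpow_mul_cos_rpow (p := 1 - a / 2) (q := 1 + a / 2)
      (by linarith) (by linarith)
    rw [← hb, Complex.ofReal_mul, ← intervalIntegral.integral_ofReal]
    unfold halfPlaneKernel
    rw [← intervalIntegral.integral_sub (hi _ _) (hi _ _), ← intervalIntegral.integral_const_mul,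
      ← intervalIntegral.integral_const_mul, intervalIntegral.integral_of_le Real.pi_pos.le,
      intervalIntegral.integral_of_le Real.pi_pos.le, integral_Ioc_eq_integral_Ioo,
      integral_Ioc_eq_integral_Ioo]
    refine setIntegral_congr_fun measurableSet_Ioo fun φ hφ => ?_
    have h3 := (exp_shift 0 φ).1
    have h4 := (exp_shift 0 φ).2
    rw [zero_add] at h3
    rw [zero_sub] at h4
    have h5 := congrArg (fun x : ℝ => (x : ℂ)) (cotWeight_mul_sin (a := a) hφ)
    push_cast at h5
    rw [h3, h4, show 2 * (1 - a / 2) - 1 = 1 - a by ring, show 2 * (1 + a / 2) - 1 = 1 + a by ring]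
    simp
    linear_combination (-2 * Complex.I) * h5
  have hS := congrArg (fun x : ℝ => (x : ℂ)) (beta_mul_sin h0 h1)
  have hkey : halfPlaneKernel a 1 0 = ((a * (Real.pi / Real.cos (Real.pi * a / 2)) : ℝ) : ℂ) -
      Complex.I * ((2 * beta (1 - a / 2) (1 + a / 2) : ℝ) : ℂ) := by
    push_cast at hre him ⊢
    linear_combination (hre + him) / 2
  have hcC : (Real.cos (Real.pi * a / 2) : ℂ) ≠ 0 := by exact_mod_cast hc
  rw [hkey, mul_comm Complex.I ((Real.pi * a / 2 : ℝ) : ℂ), Complex.exp_mul_I, ← Complex.ofReal_cos,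
    ← Complex.ofReal_sin, boundarySeq]
  rw [Complex.ofReal_div, Complex.ofReal_mul a, Complex.ofReal_div]
  rw [Complex.ofReal_mul, Complex.ofReal_mul a] at hS
  generalize ((2 * beta (1 - a / 2) (1 + a / 2) : ℝ) : ℂ) = B at hS ⊢
  field_simp
  linear_combination -hS + B * (Real.sin (Real.pi * a / 2) : ℂ) * Complex.I_sq

/-- The boundary values of `halfPlaneKernel` on the positive half line have a common phase. -/
lemma halfPlaneKernel_natCast (h0 : 0 ≤ a) (h1 : a < 1) (n : ℕ) :
    halfPlaneKernel a (n + 1 : ℕ) 0 =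
      -Complex.I * Complex.exp (Complex.I * (Real.pi * a / 2 : ℝ)) * boundarySeq a (n + 1) := by
  induction n using Nat.strong_induction_on with
  | _ n ih =>
    match n with
    | 0 => simpa using halfPlaneKernel_one h0 h1
    | 1 =>
      -- Here the coefficient n - 1 vanishes, so the value at 0, whose phase is different, never
      -- enters. From here on the coefficients are real and the phase persists.
      have h := halfPlaneKernel_recurrence h0 h1 1
      have h2 := halfPlaneKernel_one h0 h1
      rw [h2] at h
      norm_num at h ⊢
      rw [show boundarySeq a 2 = (2 * a * boundarySeq a 1 + (0 : ℕ) * boundarySeq a 0) / ((0 : ℕ) + 2) from rfl]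
      push_cast at h ⊢
      linear_combination h / 2
    | n + 2 =>
      have h := halfPlaneKernel_recurrence h0 h1 ((n + 2 : ℕ) : ℤ)
      have i1 := ih n (by omega)
      have i2 := ih (n + 1) (by omega)
      rw [show ((n + 2 : ℕ) : ℤ) + 1 = ((n + 2 + 1 : ℕ) : ℤ) by push_cast; ring,
        show ((n + 2 : ℕ) : ℤ) - 1 = ((n + 1 : ℕ) : ℤ) by push_cast; ring,
        show halfPlaneKernel a ((n + 2 : ℕ) : ℤ) 0 = halfPlaneKernel a ((n + 1 + 1 : ℕ) : ℤ) 0 from rfl,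
        i1, i2] at h
      have h3 : ((n : ℂ) + 3) ≠ 0 := by exact_mod_cast (by omega : n + 3 ≠ 0)
      rw [show boundarySeq a (n + 2 + 1) = (2 * a * boundarySeq a (n + 1 + 1) +
        ((n + 1 : ℕ) : ℝ) * boundarySeq a (n + 1)) / (((n + 1 : ℕ) : ℝ) + 2) from rfl]
      have h4 : ((n : ℂ) + 1 + 2) ≠ 0 := by
        rwa [show (n : ℂ) + 1 + 2 = n + 3 by ring]
      generalize Complex.exp (Complex.I * (Real.pi * a / 2 : ℝ)) = E at h ⊢
      generalize halfPlaneKernel a ((n + 2 + 1 : ℕ) : ℤ) 0 = H at h ⊢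
      push_cast at h ⊢
      field_simp
      linear_combination h

end SlitPlaneKernel

/-! ### Taylor coefficients of ((1+x)/(1-x))^a, the hypergeometric value and its asymptotics. -/

section CotSeries

/-- The Taylor coefficients of `((1 + x) / (1 - x)) ^ a`. -/
noncomputable def cotSeries (a : ℝ) : ℕ → ℝ
  | 0 => 1
  | 1 => 2 * a
  | n + 2 => (2 * a * cotSeries a (n + 1) + n * cotSeries a n) / (n + 2)

lemma cotSeries_rec (a : ℝ) (n : ℕ) :
    (n + 2) * cotSeries a (n + 2) = 2 * a * cotSeries a (n + 1) + n * cotSeries a n := by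
  rw [cotSeries]; field_simp

lemma boundarySeq_rec (a : ℝ) (n : ℕ) :
    (n + 2) * boundarySeq a (n + 2) = 2 * a * boundarySeq a (n + 1) + n * boundarySeq a n := by
  rw [boundarySeq]; field_simp

/-- Both sequences satisfy the same recurrence, in which the term of index 0 has coefficient 0.
Agreement at index 1 therefore suffices, although the sequences are not proportional at index 0. -/
lemma boundarySeq_eq_cotSeries {a : ℝ} (h0 : 0 < a) (h1 : a < 1) (n : ℕ) :
    boundarySeq a (n + 1) * Real.sin (Real.pi * a) = Real.pi * cotSeries a (n + 1) := by
  induction n using Nat.strong_induction_on with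
  | _ n ih =>
    match n with
    | 0 =>
      have hc := cos_pi_mul_half_pos h0.le h1
      have h := beta_mul_sin h0.le h1
      simp only [boundarySeq, cotSeries]
      have hs : Real.sin (Real.pi * a) = 2 * Real.sin (Real.pi * a / 2) * Real.cos (Real.pi * a / 2) := by
        rw [← Real.sin_two_mul]; congr 1; ring
      rw [hs]
      generalize beta (1 - a / 2) (1 + a / 2) = B at h ⊢
      generalize Real.sin (Real.pi * a / 2) = x at h ⊢
      generalize Real.cos (Real.pi * a / 2) = y at hc ⊢
      field_simp
      linear_combination h
    | 1 =>
      have h := ih 0 (by omega)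
      have r1 := boundarySeq_rec a 0
      have r2 := cotSeries_rec a 0
      norm_num at h r1 r2 ⊢
      linear_combination a * h + (1 / 2) * Real.sin (Real.pi * a) * r1 - (1 / 2) * Real.pi * r2
    | n + 2 =>
      have i1 := ih n (by omega)
      have i2 := ih (n + 1) (by omega)
      have r1 := boundarySeq_rec a (n + 1)
      have r2 := cotSeries_rec a (n + 1)
      have h3 : ((n + 1 : ℕ) : ℝ) + 2 ≠ 0 := by positivity
      refine mul_left_cancel₀ h3 ?_
      linear_combination Real.sin (Real.pi * a) * r1 - Real.pi * r2 + 2 * a * i2 +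
        ((n + 1 : ℕ) : ℝ) * i1

open PowerSeries in
/-- The sequence of coefficients of a product of two binomial series. -/
lemma binomial_product_rec {c : ℝ} {A B : ℕ → ℝ} (hA : ∀ i : ℕ, (i + 1 : ℝ) * A (i + 1) = (c - i) * A i)
    (hB : ∀ i : ℕ, (i + 1 : ℝ) * B (i + 1) = (c + i) * B i) (n : ℕ) :
    (n + 2 : ℝ) * coeff (n + 2) (mk A * mk B) =
      2 * c * coeff (n + 1) (mk A * mk B) + n * coeff n (mk A * mk B) := by
  -- The series are (1+x)^c and (1-x)^{-c}. Their differential equations combine to (1 - x²) P' = 2c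
  -- P for the product P, and comparing coefficients gives the recurrence.
  have dA : (1 + X) * derivative ℝ (mk A) = C c * mk A := by
    ext i
    rw [add_mul, one_mul, map_add, coeff_C_mul]
    cases i with
    | zero =>
      have := hA 0
      simp [coeff_derivative] at this ⊢
      linarith
    | succ i =>
      rw [coeff_succ_X_mul, coeff_derivative, coeff_derivative, coeff_mk, coeff_mk]
      have := hA (i + 1)
      push_cast at this ⊢
      linarith
  have dB : (1 - X) * derivative ℝ (mk B) = C c * mk B := by
    ext i
    rw [sub_mul, one_mul, map_sub, coeff_C_mul]
    cases i with
    | zero =>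
      have := hB 0
      simp [coeff_derivative] at this ⊢
      linarith
    | succ i =>
      rw [coeff_succ_X_mul, coeff_derivative, coeff_derivative, coeff_mk, coeff_mk]
      have := hB (i + 1)
      push_cast at this ⊢
      linarith
  have dP : derivative ℝ (mk A * mk B) - X ^ 2 * derivative ℝ (mk A * mk B) =
      C (2 * c) * (mk A * mk B) := by
    rw [Derivation.leibniz, smul_eq_mul, smul_eq_mul, map_mul, map_ofNat]
    linear_combination (1 - X) * mk B * dA + (1 + X) * mk A * dB
  have h := congrArg (coeff (n + 1)) dP
  rw [map_sub, coeff_C_mul, coeff_derivative] at h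
  cases n with
  | zero =>
    have h0 : coeff (0 + 1) (X ^ 2 * derivative ℝ (mk A * mk B)) = 0 := by
      rw [coeff_X_pow_mul']; simp
    rw [h0] at h
    push_cast at h ⊢
    linarith
  | succ n =>
    rw [show n + 1 + 1 = n + 2 by ring, coeff_X_pow_mul, coeff_derivative] at h
    push_cast at h ⊢
    linarith

/-- Taking c = -a, the product is ((1-x)/(1+x))^a, which is the defining function of `cotSeries` at
-x. -/
lemma coeff_binomial_product {a : ℝ} {A B : ℕ → ℝ} (hA0 : A 0 = 1) (hB0 : B 0 = 1)
    (hA : ∀ i : ℕ, (i + 1 : ℝ) * A (i + 1) = (-a - i) * A i)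
    (hB : ∀ i : ℕ, (i + 1 : ℝ) * B (i + 1) = (-a + i) * B i) (n : ℕ) :
    PowerSeries.coeff n (PowerSeries.mk A * PowerSeries.mk B) = (-1) ^ n * cotSeries a n := by
  induction n using Nat.strong_induction_on with
  | _ n ih =>
    match n with
    | 0 => simp [PowerSeries.coeff_mul, hA0, hB0, cotSeries]
    | 1 =>
      have h1 := hA 0
      have h2 := hB 0
      simp [hA0, hB0] at h1 h2
      rw [PowerSeries.coeff_mul, Finset.Nat.sum_antidiagonal_eq_sum_range_succ_mk]
      simp [Finset.sum_range_succ, hA0, hB0, h1, h2, cotSeries]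
      ring
    | n + 2 =>
      have h := binomial_product_rec hA hB n
      rw [ih n (by omega), ih (n + 1) (by omega)] at h
      have r := cotSeries_rec a n
      have h3 : (n : ℝ) + 2 ≠ 0 := by positivity
      refine mul_left_cancel₀ h3 ?_
      rw [h, pow_succ, pow_succ]
      linear_combination (-1) ^ n * (-1 : ℝ) * r

lemma sub_intCast_ne_zero {b : ℝ} (h0 : 0 < b) (h1 : b < 1) (m : ℤ) : b - m ≠ 0 := by
  intro h
  have h2 : b = m := by linarith
  rw [h2] at h0 h1
  have : (0 : ℤ) < m := by exact_mod_cast h0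
  have : m < 1 := by exact_mod_cast h1
  omega

lemma Gamma_sub_natCast_ne_zero {b : ℝ} (h0 : 0 < b) (h1 : b < 1) (n : ℕ) :
    Real.Gamma (b - n) ≠ 0 :=
  Real.Gamma_ne_zero fun m h => sub_intCast_ne_zero h0 h1 (n - m) (by push_cast; linarith)

lemma Gamma_mul_ascPochhammer {b : ℝ} (h0 : 0 < b) (h1 : b < 1) (N j : ℕ) :
    Real.Gamma (b - N) * (ascPochhammer ℝ j).eval (b - N) = Real.Gamma (b - N + j) := by
  induction j with
  | zero => simp
  | succ j ih =>
    rw [ascPochhammer_succ_eval, ← mul_assoc, ih, Nat.cast_succ, ← add_assoc, Real.Gamma_add_one, mul_comm]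
    have := sub_intCast_ne_zero h0 h1 (N - j)
    push_cast at this
    rwa [sub_add]

lemma ascPochhammer_neg_natCast_mul (N j : ℕ) (hj : j ≤ N) :
    (ascPochhammer ℝ j).eval (-(N : ℝ)) * (-1) ^ j * ((N - j).factorial : ℝ) = N.factorial := by
  induction j with
  | zero => simp
  | succ j ih =>
    rw [← ih (by omega), ascPochhammer_succ_eval, show N - j = (N - (j + 1)) + 1 by omega,
      Nat.factorial_succ, pow_succ]
    have : ((N - (j + 1) + 1 : ℕ) : ℝ) = N - j := by
      rw [show N - (j + 1) + 1 = N - j by omega, Nat.cast_sub (by omega)]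
    push_cast at this ⊢
    rw [this]
    ring

/-- A terminating hypergeometric value at `-1` as a Taylor coefficient. -/
lemma hypergeometric_eq_cotSeries {b : ℝ} (h0 : 0 < b) (h1 : b < 1) (N : ℕ) :
    Real.Gamma b / (Real.Gamma ((N : ℝ) + 1) * Real.Gamma (b - N)) *
      ordinaryHypergeometric (-(N : ℝ)) (b - 1) (b - N) (-1 : ℝ) = (-1) ^ N * cotSeries (1 - b) N := by
  -- These are the coefficients of (1+x)^{b-1} and (1-x)^{1-b}.
  set A : ℕ → ℝ := fun i => Real.Gamma b / (i.factorial * Real.Gamma (b - i)) with hAdef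
  set B : ℕ → ℝ := fun j => (ascPochhammer ℝ j).eval (b - 1) / j.factorial with hBdef
  have hG := Gamma_sub_natCast_ne_zero h0 h1
  have hA0 : A 0 = 1 := by
    simp [hAdef, (Real.Gamma_pos_of_pos h0).ne']
  have hB0 : B 0 = 1 := by simp [hBdef]
  have hA : ∀ i : ℕ, (i + 1 : ℝ) * A (i + 1) = (-(1 - b) - i) * A i := by
    intro i
    have e : Real.Gamma (b - i) = (b - (i + 1 : ℕ)) * Real.Gamma (b - (i + 1 : ℕ)) := by
      have h2 := sub_intCast_ne_zero h0 h1 ((i + 1 : ℕ) : ℤ)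
      rw [Int.cast_natCast] at h2
      rw [← Real.Gamma_add_one h2]
      congr 1; push_cast; ring
    have h2 := sub_intCast_ne_zero h0 h1 ((i + 1 : ℕ) : ℤ)
    rw [Int.cast_natCast] at h2
    have hG1 := hG (i + 1)
    have hf : (i.factorial : ℝ) ≠ 0 := by positivity
    simp only [hAdef]
    rw [e, Nat.factorial_succ]
    rw [show -(1 - b) - (i : ℝ) = b - (i + 1 : ℕ) by push_cast; ring]
    generalize Real.Gamma (b - (i + 1 : ℕ)) = G at hG1 ⊢
    generalize b - ((i + 1 : ℕ) : ℝ) = d at h2 ⊢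
    push_cast
    field_simp
  have hB : ∀ i : ℕ, (i + 1 : ℝ) * B (i + 1) = (-(1 - b) + i) * B i := by
    intro i
    simp only [hBdef]
    rw [ascPochhammer_succ_eval, Nat.factorial_succ]
    push_cast
    field_simp
    ring
  rw [← coeff_binomial_product hA0 hB0 hA hB N, mul_comm (PowerSeries.mk A), PowerSeries.coeff_mul,
    Finset.Nat.sum_antidiagonal_eq_sum_range_succ_mk, ordinaryHypergeometric_eq_tsum]
  dsimp only
  rw [tsum_eq_sum (s := Finset.range N.succ), Finset.mul_sum]
  · refine Finset.sum_congr rfl fun j hj => ?_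
    have hj' : j ≤ N := by simpa [Nat.lt_succ_iff] using hj
    -- The Pochhammer symbols of b - N and -N become Γ(b - (N-j)) and N!/(N-j)!, the sign of the
    -- latter absorbing the argument -1. Term j is then `A (N - j) * B j`.
    have e1 := Gamma_mul_ascPochhammer h0 h1 N j
    have e2 := ascPochhammer_neg_natCast_mul N j hj'
    rw [show b - (N : ℝ) + j = b - ((N - j : ℕ) : ℝ) by rw [Nat.cast_sub hj']; ring] at e1
    rw [PowerSeries.coeff_mk, PowerSeries.coeff_mk, Real.Gamma_nat_eq_factorial, smul_eq_mul]
    simp only [hAdef, hBdef]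
    have hG1 := hG N
    have hG2 := hG (N - j)
    have hP : (ascPochhammer ℝ j).eval (b - N) ≠ 0 := by
      intro h; rw [h, mul_zero] at e1; exact hG2 e1.symm
    rw [← e1] at hG2 ⊢
    have hf : ((N - j).factorial : ℝ) ≠ 0 := by positivity
    rw [← e2]
    have hN : (ascPochhammer ℝ j).eval (-(N : ℝ)) * (-1) ^ j * ((N - j).factorial : ℝ) ≠ 0 := by
      rw [e2]; positivity
    have hN1 : (ascPochhammer ℝ j).eval (-(N : ℝ)) ≠ 0 := fun h => hN (by rw [h]; ring)
    have hf3 : (j.factorial : ℝ) ≠ 0 := by positivity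
    field_simp
  -- The series terminates because the Pochhammer symbol of -N vanishes beyond index N.
  · intro j hj
    have hj' : N < j := by simpa [Nat.lt_succ_iff] using hj
    have : (ascPochhammer ℝ j).eval (-(N : ℝ)) = 0 :=
      (ascPochhammer_eval_eq_zero_iff j _).2 ⟨N, hj', by simp⟩
    simp [this]

lemma cos_pi_mul_lt_one {b : ℝ} (h0 : 0 < b) (h1 : b < 1) : Real.cos (Real.pi * b) < 1 := by
  have := Real.cos_lt_cos_of_nonneg_of_le_pi le_rfl (y := Real.pi * b) (by nlinarith [Real.pi_pos]) (by positivity)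
  rwa [Real.cos_zero] at this

lemma neg_one_lt_cos_pi_mul {b : ℝ} (h0 : 0 < b) (h1 : b < 1) : -1 < Real.cos (Real.pi * b) := by
  have := Real.cos_lt_cos_of_nonneg_of_le_pi (x := Real.pi * b) (y := Real.pi) (by positivity) le_rfl (by nlinarith [Real.pi_pos])
  rwa [Real.cos_pi] at this

lemma hDown_cos {b : ℝ} (h0 : 0 < b) (h1 : b < 1) {k : ℕ} (hk : 1 ≤ k) :
    hDown (Real.cos (Real.pi * b)) k = cotSeries (1 - b) (2 * k) / (1 + Real.cos (Real.pi * b)) := by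
  have hb : Real.arccos (Real.cos (Real.pi * b)) / Real.pi = b := by
    rw [Real.arccos_cos (by positivity) (by nlinarith [Real.pi_pos])]
    field_simp
  rw [hDown, if_neg (by omega), if_neg (cos_pi_mul_lt_one h0 h1).ne,
    if_neg (neg_one_lt_cos_pi_mul h0 h1).ne', hb]
  have h := hypergeometric_eq_cotSeries h0 h1 (2 * k)
  push_cast at h
  rw [pow_mul] at h
  norm_num at h
  dsimp only
  rw [mul_assoc, show -2 * (k : ℝ) = -(2 * k) by ring, h]
  ring

lemma cos_mul_hDown_cos {b : ℝ} (h0 : 0 < b) (h1 : b < 1) {k : ℕ} (hk : 1 ≤ k) :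
    Real.cos (Real.pi * b / 2) * hDown (Real.cos (Real.pi * b)) k =
      cotSeries (1 - b) (2 * k) / (2 * Real.cos (Real.pi * b / 2)) := by
  have hc := (cos_pi_mul_half_pos h0.le h1).ne'
  rw [hDown_cos h0 h1 hk, show Real.pi * b = 2 * (Real.pi * b / 2) by ring, Real.cos_two_mul,
    show 2 * (Real.pi * b / 2) / 2 = Real.pi * b / 2 by ring]
  field_simp
  ring

/-- This matches the starting value of the martingale with the right-hand side of the theorem, using
sin(π(1-b)) = 2 sin(πb/2) cos(πb/2). -/
lemma sin_mul_boundarySeq {b : ℝ} (h0 : 0 < b) (h1 : b < 1) {k : ℕ} (hk : 1 ≤ k) :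
    Real.sin (Real.pi * b / 2) / Real.pi * boundarySeq (1 - b) (2 * k) =
      Real.cos (Real.pi * b / 2) * hDown (Real.cos (Real.pi * b)) k := by
  have hc := (cos_pi_mul_half_pos h0.le h1).ne'
  have hs : Real.sin (Real.pi * b / 2) ≠ 0 :=
    (Real.sin_pos_of_pos_of_lt_pi (by positivity) (by nlinarith [Real.pi_pos])).ne'
  rw [cos_mul_hDown_cos h0 h1 hk]
  have h := boundarySeq_eq_cotSeries (a := 1 - b) (by linarith) (by linarith) (2 * k - 1)
  rw [show 2 * k - 1 + 1 = 2 * k by omega, show Real.pi * (1 - b) = Real.pi - 2 * (Real.pi * b / 2) by ring,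
    Real.sin_pi_sub, Real.sin_two_mul] at h
  field_simp
  linear_combination h

/-- The case a = 0 corresponds to β = 1, where cos(πβ/2) = 0 and the expectation has to vanish. -/
lemma boundarySeq_zero_even (k : ℕ) : boundarySeq 0 (2 * k) = 0 := by
  induction k with
  | zero => rfl
  | succ k ih =>
    rw [show 2 * (k + 1) = 2 * k + 2 by ring, boundarySeq, ih]; simp

lemma continuous_cotSeries (n : ℕ) : Continuous fun a => cotSeries a n := by
  induction n using Nat.strong_induction_on with
  | _ n ih =>
    match n with
    | 0 => exact continuous_const
    | 1 => exact continuous_const.mul continuous_id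
    | n + 2 =>
      have h1 := ih n (by omega)
      have h2 := ih (n + 1) (by omega)
      simp only [cotSeries]
      fun_prop

lemma cotSeries_one (n : ℕ) : cotSeries 1 (n + 1) = 2 := by
  induction n using Nat.strong_induction_on with
  | _ n ih =>
    match n with
    | 0 => simp [cotSeries]
    | 1 => norm_num [cotSeries]
    | n + 2 =>
      have h := cotSeries_rec 1 (n + 1)
      rw [ih n (by omega), ih (n + 1) (by omega)] at h
      have h3 : ((n + 1 : ℕ) : ℝ) + 2 ≠ 0 := by positivity
      refine mul_left_cancel₀ h3 ?_
      rw [h]; ring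

/-- At a = 1 the series is (1+x)/(1-x) = 1 + 2x + 2x² + ⋯, so the quotient tends to 2/2. The limit 1
is what forces the walk to hit the origin. -/
lemma tendsto_cos_mul_hDown_zero {k : ℕ} (hk : 1 ≤ k) :
    Tendsto (fun b => Real.cos (Real.pi * b / 2) * hDown (Real.cos (Real.pi * b)) k)
      (nhdsWithin 0 (Set.Ioi 0)) (nhds 1) := by
  have h : Tendsto (fun b => cotSeries (1 - b) (2 * k) / (2 * Real.cos (Real.pi * b / 2)))
      (nhds 0) (nhds (cotSeries (1 - 0) (2 * k) / (2 * Real.cos (Real.pi * 0 / 2)))) := by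
    refine Tendsto.div ?_ ?_ (by simp)
    · exact ((continuous_cotSeries (2 * k)).comp (continuous_const.sub continuous_id)).tendsto 0
    · exact (by fun_prop : Continuous fun b : ℝ => 2 * Real.cos (Real.pi * b / 2)).tendsto 0
  have h1 := cotSeries_one (2 * k - 1)
  rw [show 2 * k - 1 + 1 = 2 * k by omega] at h1
  norm_num [h1] at h
  refine (h.mono_left nhdsWithin_le_nhds).congr' ?_
  filter_upwards [Ioo_mem_nhdsGT (zero_lt_one' ℝ)] with b hb
  rw [cos_mul_hDown_cos hb.1 hb.2 hk]

/-- The coefficients decay like n^{-β}. The bound must be explicit in β, since later β tends to 0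
while n grows; the product is a supersolution of the recurrence. -/
lemma cotSeries_le {β : ℝ} (h0 : 0 < β) (h1 : β < 1) (n : ℕ) :
    cotSeries (1 - β) (n + 1) ≤ 2 * (1 - β) * ∏ j ∈ Finset.range n, (1 - β / (j + 2)) := by
  induction n using Nat.strong_induction_on with
  | _ n ih =>
    match n with
    | 0 => simp [cotSeries]
    | 1 =>
      simp [cotSeries]
      nlinarith
    | n + 2 =>
      have i1 := ih n (by omega)
      have i2 := ih (n + 1) (by omega)
      have r := cotSeries_rec (1 - β) (n + 1)
      rw [Finset.prod_range_succ] at i2 ⊢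
      rw [Finset.prod_range_succ]
      have hq : 0 ≤ ∏ j ∈ Finset.range n, (1 - β / ((j : ℝ) + 2)) := by
        refine Finset.prod_nonneg fun j _ => ?_
        rw [sub_nonneg, div_le_one (by positivity)]
        have : (0 : ℝ) ≤ j := by positivity
        linarith
      set q := ∏ j ∈ Finset.range n, (1 - β / ((j : ℝ) + 2)) with hqdef
      have hm : (0 : ℝ) ≤ n := by positivity
      have h3 : (0 : ℝ) < ((n + 1 : ℕ) : ℝ) + 2 := by positivity
      refine le_of_mul_le_mul_left ?_ h3
      rw [r]
      have ha : 0 < 1 - β := by linarith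
      have e1 : 2 * (1 - β) * cotSeries (1 - β) (n + 1 + 1) ≤
          2 * (1 - β) * (2 * (1 - β) * (q * (1 - β / (n + 2)))) :=
        mul_le_mul_of_nonneg_left i2 (by positivity)
      have e2 : ((n + 1 : ℕ) : ℝ) * cotSeries (1 - β) (n + 1) ≤ ((n + 1 : ℕ) : ℝ) * (2 * (1 - β) * q) :=
        mul_le_mul_of_nonneg_left i1 (by positivity)
      -- The supersolution inequality; the difference of its sides is β(1-β)/(n+2).
      have e3 : 2 * (1 - β) * (1 - β / ((n : ℝ) + 2)) + (n + 1) ≤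
          (n + 3) * ((1 - β / ((n : ℝ) + 2)) * (1 - β / ((n : ℝ) + 3))) := by
        rw [← sub_nonneg]
        have : (n + 3) * ((1 - β / ((n : ℝ) + 2)) * (1 - β / ((n : ℝ) + 3))) -
          (2 * (1 - β) * (1 - β / ((n : ℝ) + 2)) + (n + 1)) = β * (1 - β) / (n + 2) := by
          field_simp; ring
        rw [this]
        positivity
      have e4 := mul_le_mul_of_nonneg_left e3 (by positivity : 0 ≤ 2 * (1 - β) * q)
      push_cast at e2 ⊢
      rw [show (n : ℝ) + 1 + 2 = n + 3 by ring]
      nlinarith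

/-- A matching subsolution. The square in the prefactor is dictated by the coefficient of index 2,
which is 2(1-β)². -/
lemma le_cotSeries {β : ℝ} (h0 : 0 < β) (h1 : β < 1) (n : ℕ) :
    2 * (1 - β) ^ 2 * ∏ j ∈ Finset.range n, (1 + β / (j + 1))⁻¹ ≤ cotSeries (1 - β) (n + 1) := by
  induction n using Nat.strong_induction_on with
  | _ n ih =>
    match n with
    | 0 => simp [cotSeries]; nlinarith
    | 1 =>
      have : (1 + β)⁻¹ ≤ 1 := inv_le_one_of_one_le₀ (by linarith)
      simp [cotSeries]
      nlinarith [sq_nonneg (1 - β)]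
    | n + 2 =>
      have i1 := ih n (by omega)
      have i2 := ih (n + 1) (by omega)
      have r := cotSeries_rec (1 - β) (n + 1)
      rw [Finset.prod_range_succ] at i2 ⊢
      rw [Finset.prod_range_succ]
      have hq : 0 ≤ ∏ j ∈ Finset.range n, (1 + β / ((j : ℝ) + 1))⁻¹ :=
        Finset.prod_nonneg fun j _ => by positivity
      set q := ∏ j ∈ Finset.range n, (1 + β / ((j : ℝ) + 1))⁻¹ with hqdef
      have h3 : (0 : ℝ) < ((n + 1 : ℕ) : ℝ) + 2 := by positivity
      refine le_of_mul_le_mul_left ?_ h3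
      rw [r]
      have ha : 0 < 1 - β := by linarith
      have e1 : 2 * (1 - β) * (2 * (1 - β) ^ 2 * (q * (1 + β / (n + 1))⁻¹)) ≤
          2 * (1 - β) * cotSeries (1 - β) (n + 1 + 1) :=
        mul_le_mul_of_nonneg_left i2 (by positivity)
      have e2 : ((n + 1 : ℕ) : ℝ) * (2 * (1 - β) ^ 2 * q) ≤ ((n + 1 : ℕ) : ℝ) * cotSeries (1 - β) (n + 1) :=
        mul_le_mul_of_nonneg_left i1 (by positivity)
      have e3 : (n + 3) * ((1 + β / ((n : ℝ) + 1))⁻¹ * (1 + β / ((n : ℝ) + 2))⁻¹) ≤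
          2 * (1 - β) * (1 + β / ((n : ℝ) + 1))⁻¹ + (n + 1) := by
        rw [← sub_nonneg]
        have : 2 * (1 - β) * (1 + β / ((n : ℝ) + 1))⁻¹ + (n + 1) -
          (n + 3) * ((1 + β / ((n : ℝ) + 1))⁻¹ * (1 + β / ((n : ℝ) + 2))⁻¹) =
          (n + 1) * (β * (1 - β)) / ((n + 1 + β) * (n + 2 + β)) := by
          have h5 : (n : ℝ) + 1 + β ≠ 0 := by positivity
          have h6 : (n : ℝ) + 2 + β ≠ 0 := by positivity
          field_simp; ring
        rw [this]
        positivity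
      have e4 := mul_le_mul_of_nonneg_left e3 (by positivity : 0 ≤ 2 * (1 - β) ^ 2 * q)
      push_cast at e2 ⊢
      rw [show (n : ℝ) + 1 + 1 = n + 2 by ring, show (n : ℝ) + 1 + 2 = n + 3 by ring]
      nlinarith

/-- From 1 - x ≤ e^{-x} and the logarithmic lower bound for harmonic numbers; the shift by 2 in the
denominators costs the term -1. -/
lemma cotSeries_le_exp {β : ℝ} (h0 : 0 < β) (h1 : β < 1) (n : ℕ) :
    cotSeries (1 - β) (n + 1) ≤ 2 * (1 - β) * Real.exp (-(β * (Real.log (n + 1) - 1))) := by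
  refine (cotSeries_le h0 h1 n).trans (mul_le_mul_of_nonneg_left ?_ (by linarith))
  have h2 : ∏ j ∈ Finset.range n, (1 - β / ((j : ℝ) + 2)) ≤
      ∏ j ∈ Finset.range n, Real.exp (-(β / ((j : ℝ) + 2))) := by
    refine Finset.prod_le_prod (fun j _ => ?_) fun j _ => ?_
    · rw [sub_nonneg, div_le_one (by positivity)]
      have : (0 : ℝ) ≤ j := by positivity
      linarith
    · have := Real.add_one_le_exp (-(β / ((j : ℝ) + 2)))
      linarith
  refine h2.trans ?_
  rw [← Real.exp_sum, Real.exp_le_exp, Finset.sum_neg_distrib, neg_le_neg_iff]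
  have h3 := log_add_one_le_harmonic (n + 1)
  have h4 : ((harmonic (n + 1) : ℚ) : ℝ) = ∑ j ∈ Finset.range n, 1 / ((j : ℝ) + 2) + 1 := by
    rw [harmonic, Finset.sum_range_succ']
    push_cast
    simp only [one_div, inv_one, add_left_inj]
    exact Finset.sum_congr rfl fun j _ => by congr 1; ring
  have h5 : Real.log ((n : ℝ) + 1) ≤ Real.log ((n + 1 + 1 : ℕ) : ℝ) :=
    Real.log_le_log (by positivity) (by push_cast; linarith)
  have h6 : ∑ j ∈ Finset.range n, β / ((j : ℝ) + 2) = β * ∑ j ∈ Finset.range n, 1 / ((j : ℝ) + 2) := by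
    rw [Finset.mul_sum]; exact Finset.sum_congr rfl fun j _ => by ring
  rw [h6]
  exact mul_le_mul_of_nonneg_left (by linarith) h0.le

/-- From (1+x)⁻¹ ≥ e^{-x} and the logarithmic upper bound for harmonic numbers. -/
lemma exp_le_cotSeries {β : ℝ} (h0 : 0 < β) (h1 : β < 1) (n : ℕ) :
    2 * (1 - β) ^ 2 * Real.exp (-(β * (Real.log (n + 1) + 1))) ≤ cotSeries (1 - β) (n + 1) := by
  refine le_trans (mul_le_mul_of_nonneg_left ?_ (by positivity)) (le_cotSeries h0 h1 n)
  have h2 : ∏ j ∈ Finset.range n, Real.exp (-(β / ((j : ℝ) + 1))) ≤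
      ∏ j ∈ Finset.range n, (1 + β / ((j : ℝ) + 1))⁻¹ := by
    refine Finset.prod_le_prod (fun j _ => (Real.exp_pos _).le) fun j _ => ?_
    rw [Real.exp_neg]
    refine inv_anti₀ (by positivity) ?_
    linarith [Real.add_one_le_exp (β / ((j : ℝ) + 1))]
  refine le_trans ?_ h2
  rw [← Real.exp_sum, Real.exp_le_exp, Finset.sum_neg_distrib, neg_le_neg_iff]
  have h3 := harmonic_le_one_add_log n
  have h4 : ((harmonic n : ℚ) : ℝ) = ∑ j ∈ Finset.range n, 1 / ((j : ℝ) + 1) := by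
    rw [harmonic]
    push_cast
    simp only [one_div]
  have h5 : Real.log (n : ℝ) ≤ Real.log ((n : ℝ) + 1) := by
    rcases Nat.eq_zero_or_pos n with rfl | hn
    · simp
    · exact Real.log_le_log (by exact_mod_cast hn) (by linarith)
  have h6 : ∑ j ∈ Finset.range n, β / ((j : ℝ) + 1) = β * ∑ j ∈ Finset.range n, 1 / ((j : ℝ) + 1) := by
    rw [Finset.mul_sum]; exact Finset.sum_congr rfl fun j _ => by ring
  rw [h6]
  exact mul_le_mul_of_nonneg_left (by linarith) h0.le

/-- The scaling limit of `hDown` near `𝔭 = 1`. -/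
lemma tendsto_cos_mul_hDown_div_log {t : ℝ} (ht : 0 < t) :
    Tendsto (fun k : ℕ => Real.cos (Real.pi * (t / Real.log k) / 2) *
      hDown (Real.cos (Real.pi * (t / Real.log k))) k) atTop (nhds (Real.exp (-t))) := by
  have hlog : Tendsto (fun k : ℕ => Real.log k) atTop atTop :=
    Real.tendsto_log_atTop.comp tendsto_natCast_atTop_atTop
  have hβ : Tendsto (fun k : ℕ => t / Real.log k) atTop (nhds 0) := hlog.const_div_atTop t
  have hden : Tendsto (fun k : ℕ => 2 * Real.cos (Real.pi * (t / Real.log k) / 2)) atTop (nhds 2) := by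
    have := ((by fun_prop : Continuous fun b : ℝ => 2 * Real.cos (Real.pi * b / 2)).tendsto 0).comp hβ
    simpa [Function.comp_def] using this
  -- The exponent is -t - (t / log k)(log 2 + c), so the constants ±1 of the two bounds disappear in
  -- the limit.
  have hexp : ∀ c : ℝ, Tendsto (fun k : ℕ => Real.exp (-((t / Real.log k) * (Real.log (2 * k) + c)))) atTop
      (nhds (Real.exp (-t))) := by
    intro c
    refine (Real.continuous_exp.tendsto _).comp (Tendsto.neg ?_)
    have h1 : Tendsto (fun k : ℕ => t + (t / Real.log k) * (Real.log 2 + c)) atTop (nhds (t + 0 * (Real.log 2 + c))) :=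
      tendsto_const_nhds.add (hβ.mul_const _)
    rw [zero_mul, add_zero] at h1
    refine h1.congr' ?_
    filter_upwards [eventually_ge_atTop 2] with k hk
    have hk2 : (1 : ℝ) < k := by exact_mod_cast hk
    have hl := (Real.log_pos hk2).ne'
    rw [Real.log_mul two_ne_zero (by positivity)]
    field_simp
    ring
  have hnum : Tendsto (fun k : ℕ => cotSeries (1 - t / Real.log k) (2 * k)) atTop (nhds (2 * Real.exp (-t))) := by
    have hu : Tendsto (fun k : ℕ => 2 * (1 - t / Real.log k) *
        Real.exp (-((t / Real.log k) * (Real.log (2 * k) + -1)))) atTop (nhds (2 * (1 - 0) * Real.exp (-t))) :=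
      ((tendsto_const_nhds.sub hβ).const_mul 2).mul (hexp (-1))
    have hl : Tendsto (fun k : ℕ => 2 * (1 - t / Real.log k) ^ 2 *
        Real.exp (-((t / Real.log k) * (Real.log (2 * k) + 1)))) atTop (nhds (2 * (1 - 0) ^ 2 * Real.exp (-t))) :=
      (((tendsto_const_nhds.sub hβ).pow 2).const_mul 2).mul (hexp 1)
    norm_num at hu hl
    refine tendsto_of_tendsto_of_tendsto_of_le_of_le' hl hu ?_ ?_
    all_goals
      filter_upwards [hβ.eventually (gt_mem_nhds zero_lt_one), eventually_ge_atTop 2] with k hk1 hk2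
      have hk3 : (1 : ℝ) < k := by exact_mod_cast hk2
      have hpos : 0 < t / Real.log k := div_pos ht (Real.log_pos hk3)
      have e : 2 * k - 1 + 1 = 2 * k := by omega
      have e' : (((2 * k - 1 : ℕ) : ℝ)) + 1 = 2 * k := by
        exact_mod_cast e
    · have := exp_le_cotSeries hpos hk1 (2 * k - 1)
      rw [e, e'] at this
      simpa using this
    · have := cotSeries_le_exp hpos hk1 (2 * k - 1)
      rw [e, e'] at this
      simpa [sub_eq_add_neg] using this
  have hlim := hnum.div hden two_ne_zero
  rw [mul_div_cancel_left₀ _ two_ne_zero] at hlim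
  refine hlim.congr' ?_
  filter_upwards [hβ.eventually (gt_mem_nhds zero_lt_one), eventually_ge_atTop 2] with k hk1 hk2
  have hk3 : (1 : ℝ) < k := by exact_mod_cast hk2
  rw [cos_mul_hDown_cos (div_pos ht (Real.log_pos hk3)) hk1 (by omega)]
  rfl

end CotSeries

/-! ### Gluing the half-plane kernels into a harmonic function on the cover. -/

section WindingMartingale

variable {b : ℝ}

/-- The discrete harmonic function in a half plane, normalized to be `1` at the origin. -/
noncomputable def sectorKernel (b : ℝ) (u v : ℤ) : ℂ :=
  ((Real.sin (Real.pi * b / 2) / Real.pi : ℝ) : ℂ) * halfPlaneKernel (1 - b) u v.natAbs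

/-- The continuation of `sectorKernel` across the positive half line. -/
noncomputable def extendedKernel (b : ℝ) (u v : ℤ) : ℂ :=
  if 0 ≤ v then sectorKernel b u v
  else Complex.exp (-(Complex.I * (Real.pi * b : ℝ))) * sectorKernel b (-u) (-v)

lemma sectorKernel_neg (u v : ℤ) :
    sectorKernel b (-u) v = (starRingEnd ℂ) (sectorKernel b u v) := by
  rw [sectorKernel, sectorKernel, halfPlaneKernel_neg, map_mul, Complex.conj_ofReal]

lemma sin_pi_mul_half_pos (h0 : 0 < b) (h1 : b ≤ 1) : 0 < Real.sin (Real.pi * b / 2) :=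
  Real.sin_pos_of_pos_of_lt_pi (by positivity) (by nlinarith [Real.pi_pos])

lemma sectorKernel_zero_zero (h0 : 0 < b) (h1 : b ≤ 1) : sectorKernel b 0 0 = 1 := by
  rw [sectorKernel, Int.natAbs_zero, halfPlaneKernel_zero_zero (by linarith) (by linarith),
    ← Complex.ofReal_mul, show Real.pi * (1 - b) / 2 = Real.pi / 2 - Real.pi * b / 2 by ring,
    Real.cos_pi_div_two_sub]
  have := (sin_pi_mul_half_pos h0 h1).ne'
  rw [← Complex.ofReal_one]
  congr 1
  field_simp

lemma sectorKernel_natCast (h0 : 0 < b) (h1 : b ≤ 1) (n : ℕ) :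
    sectorKernel b (n + 1 : ℕ) 0 = Complex.exp (-(Complex.I * (Real.pi * b / 2 : ℝ))) *
      ((Real.sin (Real.pi * b / 2) / Real.pi * boundarySeq (1 - b) (n + 1) : ℝ) : ℂ) := by
  have hphase : -Complex.I * Complex.exp (Complex.I * (Real.pi * (1 - b) / 2 : ℝ)) =
      Complex.exp (-(Complex.I * (Real.pi * b / 2 : ℝ))) := by
    rw [show Complex.I * ((Real.pi * (1 - b) / 2 : ℝ) : ℂ) =
      (Real.pi / 2 : ℂ) * Complex.I + -(Complex.I * (Real.pi * b / 2 : ℝ)) by push_cast; ring,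
      Complex.exp_add, Complex.exp_pi_div_two_mul_I]
    linear_combination -Complex.exp (-(Complex.I * (Real.pi * b / 2 : ℝ))) * Complex.I_sq
  rw [sectorKernel, Int.natAbs_zero, halfPlaneKernel_natCast (by linarith) (by linarith), hphase]
  push_cast
  ring

lemma exp_phase (b : ℝ) :
    Complex.exp (-(Complex.I * (Real.pi * b : ℝ))) *
      (starRingEnd ℂ) (Complex.exp (-(Complex.I * (Real.pi * b / 2 : ℝ)))) =
      Complex.exp (-(Complex.I * (Real.pi * b / 2 : ℝ))) := by
  rw [← Complex.exp_conj, ← Complex.exp_add]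
  congr 1
  simp only [map_neg, map_mul, Complex.conj_I, Complex.conj_ofReal]
  push_cast
  ring

/-- Conjugate phases on the two half lines differ by e^{iπb}, the factor between consecutive half
planes. So both descriptions of a common ray agree. -/
lemma sectorKernel_boundary_neg (h0 : 0 < b) (h1 : b ≤ 1) {u : ℤ} (hu : u < 0) :
    Complex.exp (Complex.I * (Real.pi * b : ℝ)) * sectorKernel b (-u) 0 = sectorKernel b u 0 := by
  obtain ⟨n, hn⟩ : ∃ n : ℕ, -u = (n + 1 : ℕ) := ⟨(-u).toNat - 1, by omega⟩
  have h2 : sectorKernel b u 0 = (starRingEnd ℂ) (sectorKernel b (-u) 0) := by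
    rw [← sectorKernel_neg, neg_neg]
  rw [h2, hn, sectorKernel_natCast h0 h1, map_mul, Complex.conj_ofReal, ← mul_assoc]
  congr 1
  nth_rw 1 [← exp_phase b]
  rw [← mul_assoc, ← Complex.exp_add]
  simp

/-- On the ray write the boundary values at u - 1, u, u + 1 as ωy, ωx, ωz with x, y, z real. The two
neighbours above sum to 2ωx + iω(y - z), the two below to its reflection 2ωx - iω(y - z), and the
total is 4ωx. The condition 2 ≤ u keeps u - 1 positive, away from the origin with its different
phase. -/
lemma extendedKernel_harmonic (h0 : 0 < b) (h1 : b ≤ 1) {u v : ℤ}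
    (h : 0 < v ∨ v = 0 ∧ 2 ≤ u) :
    extendedKernel b (u + 1) (v + 1) + extendedKernel b (u - 1) (v + 1) +
      extendedKernel b (u + 1) (v - 1) + extendedKernel b (u - 1) (v - 1) =
      4 * extendedKernel b u v := by
  have a0 : 0 ≤ 1 - b := by linarith
  have a1 : 1 - b < 1 := by linarith
  rcases h with h | ⟨rfl, hu⟩
  · obtain ⟨n, rfl⟩ : ∃ n : ℕ, v = n + 1 := ⟨v.toNat - 1, by omega⟩
    simp only [extendedKernel]
    rw [if_pos (by omega), if_pos (by omega), if_pos (by omega), if_pos (by omega), if_pos (by omega)]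
    simp only [sectorKernel]
    rw [show ((n : ℤ) + 1 + 1).natAbs = n + 2 by omega, show ((n : ℤ) + 1 - 1).natAbs = n by omega,
      show ((n : ℤ) + 1).natAbs = n + 1 by omega]
    linear_combination ((Real.sin (Real.pi * b / 2) / Real.pi : ℝ) : ℂ) *
      halfPlaneKernel_harmonic a0 a1 u n
  · simp only [extendedKernel]
    rw [if_pos (by omega), if_pos (by omega), if_neg (by omega), if_neg (by omega), if_pos le_rfl]
    rw [sectorKernel_neg, sectorKernel_neg, show -((0 : ℤ) - 1) = 1 by norm_num, zero_add]
    have hb := halfPlaneKernel_boundary a0 a1 u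
    have hS : sectorKernel b (u + 1) 1 + sectorKernel b (u - 1) 1 = 2 * sectorKernel b u 0 +
        Complex.I * (sectorKernel b (u - 1) 0 - sectorKernel b (u + 1) 0) := by
      simp only [sectorKernel, Int.natAbs_one, Int.natAbs_zero]
      linear_combination ((Real.sin (Real.pi * b / 2) / Real.pi : ℝ) : ℂ) * hb
    obtain ⟨n, rfl⟩ : ∃ n : ℕ, u = (n + 1 + 1 : ℕ) := ⟨u.toNat - 2, by omega⟩
    rw [show ((n + 1 + 1 : ℕ) : ℤ) + 1 = ((n + 2 + 1 : ℕ) : ℤ) by push_cast; ring,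
      show ((n + 1 + 1 : ℕ) : ℤ) - 1 = ((n + 1 : ℕ) : ℤ) by push_cast; ring] at hS ⊢
    rw [sectorKernel_natCast h0 h1, sectorKernel_natCast h0 h1, sectorKernel_natCast h0 h1] at hS
    rw [sectorKernel_natCast h0 h1 (n + 1)]
    have hph := exp_phase b
    have hS2 := congrArg (starRingEnd ℂ) hS
    simp only [map_add, map_mul, map_sub, Complex.conj_ofReal, Complex.conj_I, map_ofNat] at hS2
    generalize Complex.exp (-(Complex.I * (Real.pi * b / 2 : ℝ))) = ω at *
    generalize Complex.exp (-(Complex.I * (Real.pi * b : ℝ))) = ρ at *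
    generalize ((Real.sin (Real.pi * b / 2) / Real.pi * boundarySeq (1 - b) (n + 1 + 1) : ℝ) : ℂ) = x at *
    generalize ((Real.sin (Real.pi * b / 2) / Real.pi * boundarySeq (1 - b) (n + 1) : ℝ) : ℂ) = y at *
    generalize ((Real.sin (Real.pi * b / 2) / Real.pi * boundarySeq (1 - b) (n + 2 + 1) : ℝ) : ℂ) = z at *
    linear_combination hS + ρ * hS2 + (2 * x - Complex.I * (y - z)) * hph

/-- The abscissa of a lattice point in diagonal coordinates, seen from the `m`-th half plane. -/
def sectorAbscissa (m : ℤ) (p : ℤ × ℤ) : ℤ := m.negOnePow * (p.1 + p.2)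

/-- The ordinate of a lattice point in diagonal coordinates, seen from the `m`-th half plane. -/
def sectorOrdinate (m : ℤ) (p : ℤ × ℤ) : ℤ := m.negOnePow * (p.2 - p.1)

/-- A harmonic function on the universal cover of the punctured lattice, with monodromy. -/
noncomputable def coverHarmonic (b : ℝ) (s : (ℤ × ℤ) × ℝ) : ℂ :=
  Complex.exp (Complex.I * b * roundHalfPi s.2) *
    sectorKernel b (sectorAbscissa ⌊s.2 / Real.pi⌋ s.1) (sectorOrdinate ⌊s.2 / Real.pi⌋ s.1)

/-- One step of the walk on the cover, absorbed at the origin. -/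
noncomputable def coverStep (s : (ℤ × ℤ) × ℝ) (e : ℤ × ℤ) : (ℤ × ℤ) × ℝ :=
  if s.1 = 0 then s
  else if s.1 + e = 0 then (0, s.2)
  else (s.1 + e, s.2 + Complex.arg (latticePoint (s.1 + e) / latticePoint s.1))

/-- The angular coordinate is a determination of the argument, measured from the diagonal. -/
def OnCover (s : (ℤ × ℤ) × ℝ) : Prop :=
  s.1 ≠ 0 → latticePoint s.1 * (1 - Complex.I) =
    ‖latticePoint s.1 * (1 - Complex.I)‖ * Complex.exp (s.2 * Complex.I)

lemma latticePoint_eq_zero {p : ℤ × ℤ} : latticePoint p = 0 ↔ p = 0 := by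
  simp [latticePoint, Complex.ext_iff, Prod.ext_iff]

lemma one_sub_I_ne_zero : (1 - Complex.I) ≠ 0 := by
  intro h
  have := congrArg Complex.re h
  simp at this

lemma onCover_coverStep {s : (ℤ × ℤ) × ℝ} (hs : OnCover s) (e : ℤ × ℤ) : OnCover (coverStep s e) := by
  unfold coverStep
  split_ifs with h1 h2
  · exact hs
  · exact fun h => absurd rfl h
  · intro h3
    have hz : latticePoint s.1 ≠ 0 := fun h => h1 (latticePoint_eq_zero.1 h)
    have h4 := hs h1
    set q := latticePoint (s.1 + e) / latticePoint s.1 with hq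
    have hw : latticePoint (s.1 + e) * (1 - Complex.I) = q * (latticePoint s.1 * (1 - Complex.I)) := by
      rw [hq]; field_simp
    dsimp only
    rw [hw, norm_mul, Complex.ofReal_mul, Complex.ofReal_add, add_mul, Complex.exp_add]
    nth_rw 1 [h4]
    nth_rw 1 [← Complex.norm_mul_exp_arg_mul_I q]
    ring

lemma coe_sector (m : ℤ) (p : ℤ × ℤ) :
    ((sectorAbscissa m p : ℤ) : ℂ) + (sectorOrdinate m p : ℤ) * Complex.I =
      ((m.negOnePow : ℤ) : ℂ) * (latticePoint p * (1 - Complex.I)) := by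
  have h : latticePoint p = (p.1 : ℂ) + p.2 * Complex.I := by
    apply Complex.ext <;> simp [latticePoint]
  rw [h, sectorAbscissa, sectorOrdinate]
  push_cast
  linear_combination (((m.negOnePow : ℤ) : ℂ) * p.2) * Complex.I_sq

lemma negOnePow_cases (m : ℤ) : (m.negOnePow : ℤ) = 1 ∨ (m.negOnePow : ℤ) = -1 := by
  rcases Int.even_or_odd m with h | h
  · left; rw [Int.negOnePow_even m h]; rfl
  · right; rw [Int.negOnePow_odd m h]; rfl

lemma exp_int_mul_pi (m : ℤ) : Complex.exp (m * Real.pi * Complex.I) = ((m.negOnePow : ℤ) : ℂ) := by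
  rcases Int.even_or_odd m with h | h
  · rw [Int.negOnePow_even m h]
    obtain ⟨r, rfl⟩ := h
    rw [show (((r + r : ℤ) : ℂ)) * Real.pi * Complex.I = r * (2 * Real.pi * Complex.I) by push_cast; ring,
      Complex.exp_int_mul_two_pi_mul_I]
    simp
  · rw [Int.negOnePow_odd m h]
    obtain ⟨r, rfl⟩ := h
    rw [show (((2 * r + 1 : ℤ) : ℂ)) * Real.pi * Complex.I = r * (2 * Real.pi * Complex.I) + Real.pi * Complex.I by
      push_cast; ring, Complex.exp_add, Complex.exp_int_mul_two_pi_mul_I, Complex.exp_pi_mul_I]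
    simp

/-- Multiplying by (-1)^m rotates the angle into [0, π), where it is the principal argument. This
places the point in the open half plane or on its positive boundary ray. -/
lemma sector_normal_form {p : ℤ × ℤ} {θ : ℝ} (hp : p ≠ 0) (h : OnCover (p, θ)) :
    θ = ⌊θ / Real.pi⌋ * Real.pi + Complex.arg ((sectorAbscissa ⌊θ / Real.pi⌋ p : ℤ) +
      (sectorOrdinate ⌊θ / Real.pi⌋ p : ℤ) * Complex.I) ∧
    (0 < sectorOrdinate ⌊θ / Real.pi⌋ p ∨
      sectorOrdinate ⌊θ / Real.pi⌋ p = 0 ∧ 2 ≤ sectorAbscissa ⌊θ / Real.pi⌋ p) := by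
  set m := ⌊θ / Real.pi⌋ with hm
  have hpi := Real.pi_pos
  have hm1 : m * Real.pi ≤ θ := (le_div_iff₀ hpi).1 (Int.floor_le _)
  have hm2 : θ < (m + 1) * Real.pi := (div_lt_iff₀ hpi).1 (Int.lt_floor_add_one _)
  have h' := h hp
  dsimp only at h'
  have hz : 0 < ‖latticePoint p * (1 - Complex.I)‖ := by
    rw [norm_pos_iff]
    exact mul_ne_zero (fun h => hp (latticePoint_eq_zero.1 h)) one_sub_I_ne_zero
  set r := ‖latticePoint p * (1 - Complex.I)‖
  have hsq : (((m.negOnePow : ℤ) : ℂ)) * ((m.negOnePow : ℤ) : ℂ) = 1 := by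
    rcases negOnePow_cases m with h | h <;> rw [h] <;> norm_num
  have hw : ((sectorAbscissa m p : ℤ) : ℂ) + (sectorOrdinate m p : ℤ) * Complex.I =
      r * (Complex.cos ((θ - m * Real.pi : ℝ) : ℂ) + Complex.sin ((θ - m * Real.pi : ℝ) : ℂ) * Complex.I) := by
    rw [coe_sector, h', ← Complex.exp_mul_I]
    rw [show (θ : ℂ) * Complex.I = m * Real.pi * Complex.I + ((θ - m * Real.pi : ℝ) : ℂ) * Complex.I by
      push_cast; ring, Complex.exp_add, exp_int_mul_pi]
    linear_combination (r * Complex.exp (((θ - m * Real.pi : ℝ) : ℂ) * Complex.I)) * hsq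
  have harg : Complex.arg (((sectorAbscissa m p : ℤ) : ℂ) + (sectorOrdinate m p : ℤ) * Complex.I) =
      θ - m * Real.pi := by
    rw [hw, Complex.arg_mul_cos_add_sin_mul_I hz ⟨by linarith, by linarith⟩]
  refine ⟨by rw [harg]; ring, ?_⟩
  have him : ((sectorOrdinate m p : ℤ) : ℝ) = r * Real.sin (θ - m * Real.pi) := by
    have := congrArg Complex.im hw
    simpa [← Complex.ofReal_cos, ← Complex.ofReal_sin, -Complex.ofReal_sub] using this
  have hre : ((sectorAbscissa m p : ℤ) : ℝ) = r * Real.cos (θ - m * Real.pi) := by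
    have := congrArg Complex.re hw
    simpa [← Complex.ofReal_cos, ← Complex.ofReal_sin, -Complex.ofReal_sub] using this
  rcases hm1.eq_or_lt with heq | hlt
  · right
    rw [← heq, sub_self] at him hre
    simp only [Real.sin_zero, mul_zero, Int.cast_eq_zero, Real.cos_zero, mul_one] at him hre
    refine ⟨him, ?_⟩
    have hpos : 0 < sectorAbscissa m p := by
      have : (0 : ℝ) < (sectorAbscissa m p : ℤ) := by rw [hre]; exact hz
      exact_mod_cast this
    -- The sum and the difference of the coordinates have the same parity, so a positive abscissa
    -- with ordinate 0 is at least 2.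
    unfold sectorAbscissa sectorOrdinate at *
    rcases negOnePow_cases m with h | h <;> rw [h] at him hpos ⊢ <;> omega
  · left
    have : (0 : ℝ) < (sectorOrdinate m p : ℤ) := by
      rw [him]
      exact mul_pos hz (Real.sin_pos_of_pos_of_lt_pi (by linarith) (by linarith))
    exact_mod_cast this

lemma sector_add_one (m : ℤ) (p : ℤ × ℤ) :
    sectorAbscissa (m + 1) p = -sectorAbscissa m p ∧ sectorOrdinate (m + 1) p = -sectorOrdinate m p := by
  simp [sectorAbscissa, sectorOrdinate, Int.negOnePow_succ]

lemma sector_sub_one (m : ℤ) (p : ℤ × ℤ) :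
    sectorAbscissa (m - 1) p = -sectorAbscissa m p ∧ sectorOrdinate (m - 1) p = -sectorOrdinate m p := by
  have h := sector_add_one (m - 1) p
  rw [sub_add_cancel] at h
  rw [h.1, h.2, neg_neg, neg_neg]
  exact ⟨rfl, rfl⟩

lemma floor_div_pi {θ : ℝ} {m : ℤ} (h1 : m * Real.pi ≤ θ) (h2 : θ < (m + 1) * Real.pi) :
    ⌊θ / Real.pi⌋ = m :=
  Int.floor_eq_iff.2 ⟨(le_div_iff₀ Real.pi_pos).2 h1, (div_lt_iff₀ Real.pi_pos).2 h2⟩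

/-- `coverHarmonic` in the coordinates of the `m`-th half plane, also across its boundary. -/
lemma coverHarmonic_eq_extendedKernel (h0 : 0 < b) (h1 : b ≤ 1) {p : ℤ × ℤ} {θ : ℝ} (m : ℤ)
    (hθ : θ = m * Real.pi + Complex.arg ((sectorAbscissa m p : ℤ) +
      (sectorOrdinate m p : ℤ) * Complex.I)) :
    coverHarmonic b (p, θ) = Complex.exp (Complex.I * b * (Real.pi * (m + 1 / 2) : ℝ)) *
      extendedKernel b (sectorAbscissa m p) (sectorOrdinate m p) := by
  set u := sectorAbscissa m p with hu
  set v := sectorOrdinate m p with hv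
  set w : ℂ := (u : ℂ) + v * Complex.I with hw
  have hpi := Real.pi_pos
  have hwre : w.re = u := by simp [hw]
  have hwim : w.im = v := by simp [hw]
  have harg1 := Complex.neg_pi_lt_arg w
  have harg2 := Complex.arg_le_pi w
  unfold coverHarmonic extendedKernel roundHalfPi
  dsimp only
  by_cases hv0 : 0 ≤ v
  · rw [if_pos hv0]
    have ha0 : 0 ≤ Complex.arg w := Complex.arg_nonneg_iff.2 (by rw [hwim]; exact_mod_cast hv0)
    -- An argument equal to π means the negative half line, which the floor assigns to the half
    -- plane m + 1; the boundary phases reconcile the two formulas.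
    rcases harg2.eq_or_lt with hpi' | hlt
    · obtain ⟨hr, hi⟩ := Complex.arg_eq_pi_iff.1 hpi'
      have hu0 : u < 0 := by rw [hwre] at hr; exact_mod_cast hr
      have hv' : v = 0 := by rw [hwim] at hi; exact_mod_cast hi
      have hfl : ⌊θ / Real.pi⌋ = m + 1 := by
        apply floor_div_pi <;> push_cast <;> rw [hθ, hpi'] <;> nlinarith
      rw [hfl, (sector_add_one m p).1, (sector_add_one m p).2, ← hu, ← hv, hv', neg_zero,
        ← sectorKernel_boundary_neg h0 h1 hu0, ← mul_assoc, ← Complex.exp_add]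
      congr 2
      push_cast
      ring
    · have hfl : ⌊θ / Real.pi⌋ = m := by
        apply floor_div_pi <;> rw [hθ] <;> nlinarith
      rw [hfl]
  · rw [if_neg hv0]
    have ha0 : Complex.arg w < 0 := Complex.arg_neg_iff.2 (by rw [hwim]; exact_mod_cast not_le.1 hv0)
    have hfl : ⌊θ / Real.pi⌋ = m - 1 := by
      apply floor_div_pi <;> push_cast <;> rw [hθ] <;> nlinarith
    rw [hfl, (sector_sub_one m p).1, (sector_sub_one m p).2, ← hu, ← hv, ← mul_assoc, ← Complex.exp_add]
    congr 2
    push_cast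
    ring

lemma arg_div_eq_sub {z w : ℂ} (hz : z ≠ 0) (hw : w ≠ 0) (h1 : -Real.pi < w.arg - z.arg)
    (h2 : w.arg - z.arg ≤ Real.pi) : (w / z).arg = w.arg - z.arg := by
  have h := Complex.arg_div_coe_angle hw hz
  rw [← Real.Angle.coe_sub] at h
  have h3 := congrArg Real.Angle.toReal h
  rwa [Complex.arg_coe_angle_toReal_eq_arg, Real.Angle.toReal_coe_eq_self_iff.2 ⟨h1, h2⟩] at h3

/-- All four neighbours can be read in the chart of the current half plane. From positive ordinate a
step cannot go below ordinate 0, and from the ray the initial argument is 0; so the difference of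
arguments stays in (-π, π] and no turn is lost. -/
lemma coverHarmonic_coverStep (h0 : 0 < b) (h1 : b ≤ 1) {p : ℤ × ℤ} {θ : ℝ} (hp : p ≠ 0)
    (h : OnCover (p, θ)) {e : ℤ × ℤ} (he : e ∈ unitSteps) :
    coverHarmonic b (coverStep (p, θ) e) =
      Complex.exp (Complex.I * b * (Real.pi * (⌊θ / Real.pi⌋ + 1 / 2) : ℝ)) *
      extendedKernel b (sectorAbscissa ⌊θ / Real.pi⌋ p + sectorAbscissa ⌊θ / Real.pi⌋ e)
        (sectorOrdinate ⌊θ / Real.pi⌋ p + sectorOrdinate ⌊θ / Real.pi⌋ e) := by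
  obtain ⟨hθ, hpos⟩ := sector_normal_form hp h
  set m := ⌊θ / Real.pi⌋ with hm
  have hadd1 : sectorAbscissa m p + sectorAbscissa m e = sectorAbscissa m (p + e) := by
    simp only [sectorAbscissa, Prod.fst_add, Prod.snd_add]; ring
  have hadd2 : sectorOrdinate m p + sectorOrdinate m e = sectorOrdinate m (p + e) := by
    simp only [sectorOrdinate, Prod.fst_add, Prod.snd_add]; ring
  have hstep : -1 ≤ sectorOrdinate m e := by
    simp only [unitSteps, Finset.mem_insert, Finset.mem_singleton] at he
    unfold sectorOrdinate
    rcases negOnePow_cases m with h | h <;> rw [h] <;> rcases he with rfl | rfl | rfl | rfl <;> norm_num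
  unfold coverStep
  dsimp only
  rw [if_neg hp, hadd1, hadd2]
  split_ifs with hpe
  -- The step into the origin keeps the angle, hence the current half plane and its phase.
  · rw [hpe]
    simp only [coverHarmonic, roundHalfPi, ← hm]
    simp [sectorAbscissa, sectorOrdinate, extendedKernel]
  · have hs : ((m.negOnePow : ℤ) : ℂ) ≠ 0 := by
      rcases negOnePow_cases m with h | h <;> rw [h] <;> norm_num
    have hz0 : latticePoint p ≠ 0 := fun h => hp (latticePoint_eq_zero.1 h)
    have hw0 : latticePoint (p + e) ≠ 0 := fun h => hpe (latticePoint_eq_zero.1 h)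
    have hquot : latticePoint (p + e) / latticePoint p =
        (((sectorAbscissa m (p + e) : ℤ) : ℂ) + (sectorOrdinate m (p + e) : ℤ) * Complex.I) /
        (((sectorAbscissa m p : ℤ) : ℂ) + (sectorOrdinate m p : ℤ) * Complex.I) := by
      rw [coe_sector, coe_sector, mul_div_mul_left _ _ hs, mul_div_mul_right _ _ one_sub_I_ne_zero]
    have hz1 : ((sectorAbscissa m p : ℤ) : ℂ) + (sectorOrdinate m p : ℤ) * Complex.I ≠ 0 := by
      rw [coe_sector]; exact mul_ne_zero hs (mul_ne_zero hz0 one_sub_I_ne_zero)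
    have hw1 : ((sectorAbscissa m (p + e) : ℤ) : ℂ) + (sectorOrdinate m (p + e) : ℤ) * Complex.I ≠ 0 := by
      rw [coe_sector]; exact mul_ne_zero hs (mul_ne_zero hw0 one_sub_I_ne_zero)
    have hbounds : -Real.pi < Complex.arg (((sectorAbscissa m (p + e) : ℤ) : ℂ) +
          (sectorOrdinate m (p + e) : ℤ) * Complex.I) -
          Complex.arg (((sectorAbscissa m p : ℤ) : ℂ) + (sectorOrdinate m p : ℤ) * Complex.I) ∧
        Complex.arg (((sectorAbscissa m (p + e) : ℤ) : ℂ) +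
          (sectorOrdinate m (p + e) : ℤ) * Complex.I) -
          Complex.arg (((sectorAbscissa m p : ℤ) : ℂ) + (sectorOrdinate m p : ℤ) * Complex.I) ≤ Real.pi := by
      set w : ℂ := ((sectorAbscissa m (p + e) : ℤ) : ℂ) + (sectorOrdinate m (p + e) : ℤ) * Complex.I with hw
      set z : ℂ := ((sectorAbscissa m p : ℤ) : ℂ) + (sectorOrdinate m p : ℤ) * Complex.I with hz
      have hzre : z.re = (sectorAbscissa m p : ℤ) := by simp [hz]
      have hzim : z.im = (sectorOrdinate m p : ℤ) := by simp [hz]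
      have hwim : w.im = (sectorOrdinate m (p + e) : ℤ) := by simp [hw]
      rcases hpos with hpos | ⟨hv, hu⟩
      · have hz2 : 0 ≤ z.arg := Complex.arg_nonneg_iff.2 (by rw [hzim]; exact_mod_cast hpos.le)
        have hz3 : z.arg < Real.pi := lt_of_le_of_ne (Complex.arg_le_pi z) fun h => by
          have := (Complex.arg_eq_pi_iff.1 h).2
          rw [hzim] at this
          have : sectorOrdinate m p = 0 := by exact_mod_cast this
          omega
        have hw2 : 0 ≤ w.arg := Complex.arg_nonneg_iff.2 (by
          rw [hwim]; exact_mod_cast (by omega : 0 ≤ sectorOrdinate m (p + e)))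
        exact ⟨by linarith, by linarith [Complex.arg_le_pi w]⟩
      · have hz2 : z.arg = 0 := Complex.arg_eq_zero_iff.2
          ⟨by rw [hzre]; exact_mod_cast (by omega : 0 ≤ sectorAbscissa m p),
            by rw [hzim]; exact_mod_cast hv⟩
        rw [hz2, sub_zero]
        exact ⟨Complex.neg_pi_lt_arg w, Complex.arg_le_pi w⟩
    refine coverHarmonic_eq_extendedKernel h0 h1 m ?_
    rw [hquot, arg_div_eq_sub hz1 hw1 hbounds.1 hbounds.2]
    nth_rw 1 [hθ]
    ring

/-- `coverHarmonic` is harmonic for the walk on the cover. -/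
lemma coverHarmonic_mean (h0 : 0 < b) (h1 : b ≤ 1) {s : (ℤ × ℤ) × ℝ} (h : OnCover s) :
    (1 / 4 : ℂ) * ∑ e ∈ unitSteps, coverHarmonic b (coverStep s e) = coverHarmonic b s := by
  obtain ⟨p, θ⟩ := s
  by_cases hp : p = 0
  · have : ∀ e, coverStep (p, θ) e = (p, θ) := fun e => by simp [coverStep, hp]
    simp only [this, sum_unitSteps]
    ring
  · rw [Finset.sum_congr rfl fun e he => coverHarmonic_coverStep h0 h1 hp h he, sum_unitSteps]
    obtain ⟨hθ, hpos⟩ := sector_normal_form hp h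
    have hW : coverHarmonic b (p, θ) = _ := coverHarmonic_eq_extendedKernel h0 h1 ⌊θ / Real.pi⌋ hθ
    rw [hW]
    have hH := extendedKernel_harmonic h0 h1 hpos
    set m := ⌊θ / Real.pi⌋
    generalize sectorAbscissa m p = u at *
    generalize sectorOrdinate m p = v at *
    generalize Complex.exp (Complex.I * b * (Real.pi * (m + 1 / 2) : ℝ)) = E
    simp only [sectorAbscissa, sectorOrdinate]
    rcases negOnePow_cases m with h | h <;> rw [h] <;>
      norm_num [← sub_eq_add_neg] <;> linear_combination (E / 4) * hH

lemma coverHarmonic_origin (h0 : 0 < b) (h1 : b ≤ 1) (θ : ℝ) :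
    coverHarmonic b (0, θ) = Complex.exp (Complex.I * b * roundHalfPi θ) := by
  simp [coverHarmonic, sectorAbscissa, sectorOrdinate, sectorKernel_zero_zero h0 h1]

/-- The phase has modulus 1, so the bound depends only on |y - x| and not on the sheet; it thus
follows the escaping coordinate. -/
lemma norm_coverHarmonic_le (h0 : 0 < b) (h1 : b ≤ 1) (s : (ℤ × ℤ) × ℝ) :
    ‖coverHarmonic b s‖ ≤ kernelBound (1 - b) (s.1.2 - s.1.1).natAbs := by
  unfold coverHarmonic sectorKernel
  rw [show Complex.I * (b : ℂ) * roundHalfPi s.2 = ((b * roundHalfPi s.2 : ℝ) : ℂ) * Complex.I by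
    push_cast; ring, norm_mul, Complex.norm_exp_ofReal_mul_I, one_mul, norm_mul]
  have h2 : (sectorOrdinate ⌊s.2 / Real.pi⌋ s.1).natAbs = (s.1.2 - s.1.1).natAbs := by
    unfold sectorOrdinate
    rcases negOnePow_cases ⌊s.2 / Real.pi⌋ with h | h <;> rw [h] <;> omega
  rw [h2]
  have h3 : ‖((Real.sin (Real.pi * b / 2) / Real.pi : ℝ) : ℂ)‖ ≤ 1 := by
    rw [Complex.norm_real, Real.norm_eq_abs, abs_div, abs_of_pos Real.pi_pos, div_le_one Real.pi_pos]
    linarith [Real.abs_sin_le_one (Real.pi * b / 2), Real.pi_gt_three]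
  calc _ ≤ 1 * kernelBound (1 - b) (s.1.2 - s.1.1).natAbs :=
        mul_le_mul h3 (norm_halfPlaneKernel_le (by linarith) (by linarith) _ _) (norm_nonneg _) zero_le_one
    _ = _ := one_mul _

/-- The phase e^{iπb/2} of the half plane 0 cancels the phase of the boundary value, leaving a real
number. -/
lemma coverHarmonic_start (h0 : 0 < b) (h1 : b ≤ 1) {k : ℕ} (hk : 1 ≤ k) :
    coverHarmonic b (((k : ℤ), (k : ℤ)), 0) =
      ((Real.sin (Real.pi * b / 2) / Real.pi * boundarySeq (1 - b) (2 * k) : ℝ) : ℂ) := by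
  have h := sectorKernel_natCast h0 h1 (2 * k - 1)
  rw [show 2 * k - 1 + 1 = 2 * k by omega] at h
  unfold coverHarmonic roundHalfPi sectorAbscissa sectorOrdinate
  simp only [zero_div, Int.floor_zero, Int.negOnePow_zero, Units.val_one, one_mul, sub_self]
  rw [show (k : ℤ) + k = ((2 * k : ℕ) : ℤ) by push_cast; ring, h, ← mul_assoc, ← Complex.exp_add]
  rw [show Complex.I * (b : ℂ) * ((Real.pi * (((0 : ℤ) : ℝ) + 1 / 2) : ℝ) : ℂ) +
    -(Complex.I * ((Real.pi * b / 2 : ℝ) : ℂ)) = 0 by push_cast; ring, Complex.exp_zero, one_mul]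

lemma measurable_coverStep (e : ℤ × ℤ) : Measurable fun s => coverStep s e := by
  unfold coverStep
  have hd : ∀ q : ℤ × ℤ → Prop, MeasurableSet {s : (ℤ × ℤ) × ℝ | q s.1} := fun q =>
    measurable_fst (Set.to_countable {x | q x}).measurableSet
  have hf : Measurable fun s : (ℤ × ℤ) × ℝ => Complex.arg (latticePoint (s.1 + e) / latticePoint s.1) :=
    (Measurable.of_discrete (f := fun p : ℤ × ℤ =>
      Complex.arg (latticePoint (p + e) / latticePoint p))).comp measurable_fst
  have hg : Measurable fun s : (ℤ × ℤ) × ℝ => s.1 + e :=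
    (Measurable.of_discrete (f := fun p : ℤ × ℤ => p + e)).comp measurable_fst
  refine Measurable.ite (hd fun x => x = 0) measurable_id (Measurable.ite (hd fun x => x + e = 0) ?_ ?_)
  · exact measurable_const.prodMk measurable_snd
  · exact hg.prodMk (measurable_snd.add hf)

lemma measurable_roundHalfPi : Measurable roundHalfPi := by
  unfold roundHalfPi
  have h : Measurable fun θ : ℝ => ((⌊θ / Real.pi⌋ : ℤ) : ℝ) :=
    (Measurable.of_discrete (f := fun z : ℤ => (z : ℝ))).comp
      (Int.measurable_floor.comp (measurable_id.div_const _))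
  fun_prop

lemma measurable_coverHarmonic : Measurable (coverHarmonic b) := by
  have h1 : Measurable fun s : (ℤ × ℤ) × ℝ => ((roundHalfPi s.2 : ℝ) : ℂ) :=
    Complex.measurable_ofReal.comp (measurable_roundHalfPi.comp measurable_snd)
  have h2 : Measurable fun s : (ℤ × ℤ) × ℝ => ⌊s.2 / Real.pi⌋ :=
    Int.measurable_floor.comp (Measurable.div_const measurable_snd Real.pi)
  have h3 : ∀ K : ℤ × (ℤ × ℤ) → ℂ, Measurable fun s : (ℤ × ℤ) × ℝ => K (⌊s.2 / Real.pi⌋, s.1) :=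
    fun K => (Measurable.of_discrete (f := K)).comp (h2.prodMk measurable_fst)
  have h4 := h3 fun q => sectorKernel b (sectorAbscissa q.1 q.2) (sectorOrdinate q.1 q.2)
  have h5 : Measurable fun s : (ℤ × ℤ) × ℝ => Complex.exp (Complex.I * b * roundHalfPi s.2) :=
    Complex.measurable_exp.comp (h1.const_mul (Complex.I * b))
  have h6 : coverHarmonic b = fun s => Complex.exp (Complex.I * b * roundHalfPi s.2) *
      sectorKernel b (sectorAbscissa ⌊s.2 / Real.pi⌋ s.1) (sectorOrdinate ⌊s.2 / Real.pi⌋ s.1) := by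
    funext s
    rw [coverHarmonic]
  rw [h6]
  exact h5.mul h4

end WindingMartingale

/-! ### Hitting the origin and the characteristic function of the rounded winding angle. -/

section Winding

lemma coverOrbit_eq {x : ℕ → ℤ × ℤ} {n : ℕ} (h : ∀ i ≤ n, x i ≠ 0) :
    drivenOrbit coverStep (x 0, 0) (fun i => x (i + 1) - x i) n = (x n, windingAngle x n) := by
  induction n with
  | zero => simp [drivenOrbit, windingAngle]
  | succ n ih =>
    rw [drivenOrbit, ih fun i hi => h i (by omega)]
    unfold coverStep
    rw [if_neg (h n (by omega)), if_neg (by simpa using h (n + 1) le_rfl)]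
    simp [windingAngle, Finset.sum_range_succ]

lemma hittingTimeOrigin_spec {x : ℕ → ℤ × ℤ} (h : ∃ n, x n = 0) : x (hittingTimeOrigin x) = 0 :=
  Nat.sInf_mem (s := {n | x n = 0}) h

lemma ne_zero_of_lt_hittingTimeOrigin {x : ℕ → ℤ × ℤ} {n : ℕ} (h : n < hittingTimeOrigin x) :
    x n ≠ 0 :=
  Nat.notMem_of_lt_sInf (s := {n | x n = 0}) h

lemma coverOrbit_absorbed {x : ℕ → ℤ × ℤ} (h0 : x 0 ≠ 0) (h : ∃ n, x n = 0) {n : ℕ}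
    (hn : hittingTimeOrigin x ≤ n) :
    drivenOrbit coverStep (x 0, 0) (fun i => x (i + 1) - x i) n = (0, totalWindingAngle x) := by
  have hspec := hittingTimeOrigin_spec h
  -- The hitting time is positive, so subtracting 1 from it in the total winding angle is not
  -- truncated.
  have hpos : hittingTimeOrigin x ≠ 0 := fun h1 => h0 (h1 ▸ hspec)
  induction n, hn using Nat.le_induction with
  | base =>
    obtain ⟨m, hm⟩ := Nat.exists_eq_succ_of_ne_zero hpos
    have h2 : ∀ i ≤ m, x i ≠ 0 := fun i hi => ne_zero_of_lt_hittingTimeOrigin (by omega)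
    rw [totalWindingAngle, hm, drivenOrbit, coverOrbit_eq h2]
    rw [hm] at hspec
    unfold coverStep
    rw [if_neg (h2 m le_rfl), if_pos (by simpa using hspec)]
    simp
  | succ n hn ih =>
    rw [drivenOrbit, ih]
    simp [coverStep]

lemma antidiagonalOrbit_eq {x : ℕ → ℤ × ℤ} (h : (x 0).1 = (x 0).2) (n : ℕ) :
    drivenOrbit antidiagonalStep 0 (fun i => x (i + 1) - x i) n = (x n).2 - (x n).1 := by
  induction n with
  | zero => simp [drivenOrbit, h]
  | succ n ih =>
    rw [drivenOrbit, ih, antidiagonalStep]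
    simp only [Prod.fst_sub, Prod.snd_sub]
    ring

lemma onCover_drivenOrbit {s : (ℤ × ℤ) × ℝ} (hs : OnCover s) (e : ℕ → ℤ × ℤ) (n : ℕ) :
    OnCover (drivenOrbit coverStep s e n) := by
  induction n with
  | zero => exact hs
  | succ n ih => exact onCover_coverStep ih _

lemma onCover_start (k : ℕ) : OnCover (((k : ℤ), (k : ℤ)), 0) := by
  intro _
  have h : latticePoint ((k : ℤ), (k : ℤ)) * (1 - Complex.I) = ((2 * k : ℝ) : ℂ) := by
    apply Complex.ext <;> simp [latticePoint]
    ring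
  dsimp only
  rw [h, Complex.norm_real, Real.norm_of_nonneg (by positivity)]
  simp

variable {Ω : Type*} [MeasurableSpace Ω] {P : Measure Ω}
  {X : ℕ → Ω → ℤ × ℤ} {k : ℕ}

lemma IsSimpleRandomWalk.measurable_increment {x : ℤ × ℤ} (hX : IsSimpleRandomWalk P X x) (n : ℕ) :
    Measurable fun ω => X (n + 1) ω - X n ω :=
  (Measurable.of_discrete (f := fun q : (ℤ × ℤ) × (ℤ × ℤ) => q.1 - q.2)).comp
    ((hX.measurable (n + 1)).prodMk (hX.measurable n))

/-- The martingale property in integrated form: harmonicity holds at every state of the orbit,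
because the orbit never leaves the set `OnCover`. -/
lemma integral_coverHarmonic [IsProbabilityMeasure P] (hk : 1 ≤ k) (hX : IsSimpleRandomWalk P X ((k : ℤ), (k : ℤ))) {b : ℝ}
    (h0 : 0 < b) (h1 : b ≤ 1) (n : ℕ) :
    ∫ ω, coverHarmonic b (drivenOrbit coverStep (((k : ℤ), (k : ℤ)), 0)
      (fun i => X (i + 1) ω - X i ω) n) ∂P =
      ((Real.sin (Real.pi * b / 2) / Real.pi * boundarySeq (1 - b) (2 * k) : ℝ) : ℂ) := by
  induction n with
  | zero => simp only [drivenOrbit, integral_const, probReal_univ, one_smul, coverHarmonic_start h0 h1 hk]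
  | succ n ih =>
    rw [integral_drivenOrbit_succ measurable_coverStep _ hX.measurable_increment hX.indep hX.uniform
      measurable_coverHarmonic (C := kernelBound (1 - b) 0)
      (fun s => (norm_coverHarmonic_le h0 h1 s).trans (kernelBound_le (by linarith) (by linarith) _)), ← ih]
    refine integral_congr_ae (ae_of_all _ fun ω => ?_)
    exact coverHarmonic_mean h0 h1 (onCover_drivenOrbit (onCover_start k) _ n)

lemma start_ne_zero (hk : 1 ≤ k) : ((k : ℤ), (k : ℤ)) ≠ (0 : ℤ × ℤ) := by
  intro h
  have := congrArg Prod.fst h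
  simp at this
  omega

lemma measurableSet_hits {x : ℤ × ℤ} (hX : IsSimpleRandomWalk P X x) :
    MeasurableSet {ω | ∃ n, X n ω = 0} := by
  rw [Set.ofPred_exists]
  exact MeasurableSet.iUnion fun n => hX.measurable n (measurableSet_singleton 0)

lemma tendsto_kernelBound_natAbs {a : ℝ} (h0 : 0 ≤ a) (h1 : a < 1) :
    Tendsto (fun v : ℤ => kernelBound a v.natAbs) cofinite (nhds 0) := by
  refine (tendsto_kernelBound h0 h1).comp ?_
  rw [← Nat.cofinite_eq_atTop, Tendsto]
  intro s hs
  rw [mem_cofinite] at hs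
  rw [mem_map, mem_cofinite]
  refine (Set.Finite.union (hs.image fun n : ℕ => (n : ℤ)) (hs.image fun n : ℕ => -(n : ℤ))).subset ?_
  intro v hv
  rcases Int.natAbs_eq v with h | h
  · exact Or.inl ⟨v.natAbs, hv, h.symm⟩
  · exact Or.inr ⟨v.natAbs, hv, h.symm⟩

/-- The hitting probability of the origin dominates each value of the harmonic function. -/
lemma le_measure_hits [IsProbabilityMeasure P] (hk : 1 ≤ k) (hX : IsSimpleRandomWalk P X ((k : ℤ), (k : ℤ))) {b : ℝ}
    (h0 : 0 < b) (h1 : b < 1) :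
    Real.cos (Real.pi * b / 2) * hDown (Real.cos (Real.pi * b)) k ≤ P.real {ω | ∃ n, X n ω = 0} := by
  set A := {ω | ∃ n, X n ω = 0} with hA
  have hAm : MeasurableSet A := measurableSet_hits hX
  set V : ℕ → Ω → ℤ := fun n ω => drivenOrbit antidiagonalStep 0 (fun i => X (i + 1) ω - X i ω) n with hV
  have hVm : ∀ n, Measurable (V n) :=
    measurable_drivenOrbit (fun e => Measurable.of_discrete) 0 hX.measurable_increment
  have hb0 : 0 ≤ 1 - b := by linarith
  have hb1 : 1 - b < 1 := by linarith
  have hlim := tendsto_integral_antidiagonal hX.measurable_increment hX.indep hX.uniform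
    (tendsto_kernelBound_natAbs hb0 hb1) (fun v => kernelBound_nonneg _) (fun v => kernelBound_le hb0 hb1 _)
  -- Before absorption the modulus is controlled by the decay in |y - x|; after absorption it is 1
  -- and the path lies in the hitting event.
  have hpt : ∀ n, ∀ᵐ ω ∂P, ‖coverHarmonic b (drivenOrbit coverStep (((k : ℤ), (k : ℤ)), 0)
      (fun i => X (i + 1) ω - X i ω) n)‖ ≤
      A.indicator (fun _ => (1 : ℝ)) ω + kernelBound (1 - b) (V n ω).natAbs := by
    intro n
    filter_upwards [hX.initial] with ω hω
    have hx0 : (fun m => X m ω) 0 ≠ 0 := by dsimp only; rw [hω]; exact start_ne_zero hk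
    have hnn := kernelBound_nonneg (a := 1 - b) (V n ω).natAbs
    by_cases hall : ∀ i ≤ n, X i ω ≠ 0
    · have h2 := coverOrbit_eq (x := fun m => X m ω) hall
      rw [hω] at h2
      rw [h2]
      have h3 := norm_coverHarmonic_le h0 h1.le (X n ω, windingAngle (fun m => X m ω) n)
      have h4 := antidiagonalOrbit_eq (x := fun m => X m ω) (by simp [hω]) n
      dsimp only at h3
      rw [← h4] at h3
      have h5 : 0 ≤ A.indicator (fun _ => (1 : ℝ)) ω := Set.indicator_nonneg (fun _ _ => zero_le_one) _
      linarith
    · push Not at hall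
      obtain ⟨i, hi, hi0⟩ := hall
      have hex : ∃ n, (fun m => X m ω) n = 0 := ⟨i, hi0⟩
      have h2 := coverOrbit_absorbed hx0 hex (n := n) ((Nat.sInf_le hi0).trans hi)
      rw [hω] at h2
      have hmem : ω ∈ A := hex
      rw [h2, coverHarmonic_origin h0 h1.le, Set.indicator_of_mem hmem,
        show Complex.I * (b : ℂ) * roundHalfPi (totalWindingAngle fun m => X m ω) =
          ((b * roundHalfPi (totalWindingAngle fun m => X m ω) : ℝ) : ℂ) * Complex.I by push_cast; ring,
        Complex.norm_exp_ofReal_mul_I]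
      linarith
  have hle : ∀ n, Real.cos (Real.pi * b / 2) * hDown (Real.cos (Real.pi * b)) k ≤
      P.real A + ∫ ω, kernelBound (1 - b) (V n ω).natAbs ∂P := by
    intro n
    have hi1 : Integrable (A.indicator (fun _ => (1 : ℝ))) P := (integrable_const 1).indicator hAm
    have hi2 : Integrable (fun ω => kernelBound (1 - b) (V n ω).natAbs) P := by
      refine Integrable.of_bound (C := kernelBound (1 - b) 0) ((Measurable.of_discrete (f := fun v : ℤ =>
        kernelBound (1 - b) v.natAbs)).comp (hVm n)).aestronglyMeasurable (ae_of_all _ fun ω => ?_)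
      rw [Real.norm_eq_abs, abs_of_nonneg (kernelBound_nonneg _)]
      exact kernelBound_le hb0 hb1 _
    have h2 := integral_coverHarmonic hk hX h0 h1.le n
    rw [sin_mul_boundarySeq h0 h1 hk] at h2
    calc _ ≤ ‖((Real.cos (Real.pi * b / 2) * hDown (Real.cos (Real.pi * b)) k : ℝ) : ℂ)‖ := by
          rw [Complex.norm_real]; exact le_abs_self _
      _ ≤ ∫ ω, (A.indicator (fun _ => (1 : ℝ)) ω + kernelBound (1 - b) (V n ω).natAbs) ∂P := by
          rw [← h2]
          exact norm_integral_le_of_norm_le (hi1.add hi2) (hpt n)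
      _ = _ := by
          rw [integral_add hi1 hi2, integral_indicator_const _ hAm]; simp
  have h3 := hlim.const_add (P.real A)
  rw [add_zero] at h3
  exact ge_of_tendsto' h3 hle

/-- The walk hits the origin almost surely. -/
lemma ae_hits [IsProbabilityMeasure P] (hk : 1 ≤ k) (hX : IsSimpleRandomWalk P X ((k : ℤ), (k : ℤ))) :
    ∀ᵐ ω ∂P, ∃ n, X n ω = 0 := by
  have h1 : (1 : ℝ) ≤ P.real {ω | ∃ n, X n ω = 0} := by
    refine le_of_tendsto (tendsto_cos_mul_hDown_zero hk) ?_
    filter_upwards [Ioo_mem_nhdsGT (zero_lt_one' ℝ)] with b hb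
    exact le_measure_hits hk hX hb.1 hb.2
  have h2 : P.real {ω | ∃ n, X n ω = 0} = 1 := le_antisymm measureReal_le_one h1
  have h3 : P {ω | ∃ n, X n ω = 0} = 1 := by
    rw [measureReal_def] at h2
    rw [← ENNReal.ofReal_toReal (measure_ne_top P _), h2, ENNReal.ofReal_one]
  exact (prob_compl_eq_zero_iff (measurableSet_hits hX)).2 h3

lemma ae_coverOrbit_eventually [IsProbabilityMeasure P] (hk : 1 ≤ k) (hX : IsSimpleRandomWalk P X ((k : ℤ), (k : ℤ))) :
    ∀ᵐ ω ∂P, ∀ᶠ n in atTop, drivenOrbit coverStep (((k : ℤ), (k : ℤ)), 0)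
      (fun i => X (i + 1) ω - X i ω) n = (0, totalWindingAngle fun m => X m ω) := by
  filter_upwards [hX.initial, ae_hits hk hX] with ω hω hhit
  have hx0 : (fun m => X m ω) 0 ≠ 0 := by dsimp only; rw [hω]; exact start_ne_zero hk
  filter_upwards [eventually_ge_atTop (hittingTimeOrigin fun m => X m ω)] with n hn
  have h2 := coverOrbit_absorbed hx0 hhit hn
  rwa [hω] at h2

/-- The angle of the absorbed orbit is almost surely eventually constant, so the total winding is an
almost sure limit of measurable functions. -/
lemma aemeasurable_totalWindingAngle [IsProbabilityMeasure P] (hk : 1 ≤ k)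
    (hX : IsSimpleRandomWalk P X ((k : ℤ), (k : ℤ))) :
    AEMeasurable (fun ω => totalWindingAngle fun m => X m ω) P := by
  refine aemeasurable_of_tendsto_metrizable_ae atTop (f := fun n ω =>
    (drivenOrbit coverStep (((k : ℤ), (k : ℤ)), 0) (fun i => X (i + 1) ω - X i ω) n).2) (fun n => ?_) ?_
  · exact (measurable_snd.comp (measurable_drivenOrbit measurable_coverStep _
      hX.measurable_increment n)).aemeasurable
  · filter_upwards [ae_coverOrbit_eventually hk hX] with ω hω
    refine tendsto_const_nhds.congr' ?_
    filter_upwards [hω] with n hn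
    rw [hn]

lemma norm_exp_I_mul_mul (β x : ℝ) : ‖Complex.exp (Complex.I * β * x)‖ = 1 := by
  rw [show Complex.I * (β : ℂ) * x = ((β * x : ℝ) : ℂ) * Complex.I by push_cast; ring,
    Complex.norm_exp_ofReal_mul_I]

/-- Optional stopping by dominated convergence: the bounded martingale has constant mean and is
eventually equal to its value at the origin. -/
lemma integral_exp_roundHalfPi_of_pos [IsProbabilityMeasure P] (hk : 1 ≤ k)
    (hX : IsSimpleRandomWalk P X ((k : ℤ), (k : ℤ))) {b : ℝ} (h0 : 0 < b) (h1 : b ≤ 1) :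
    ∫ ω, Complex.exp (Complex.I * b * roundHalfPi (totalWindingAngle fun m => X m ω)) ∂P =
      ((Real.sin (Real.pi * b / 2) / Real.pi * boundarySeq (1 - b) (2 * k) : ℝ) : ℂ) := by
  have hlim : Tendsto (fun n => ∫ ω, coverHarmonic b (drivenOrbit coverStep (((k : ℤ), (k : ℤ)), 0)
      (fun i => X (i + 1) ω - X i ω) n) ∂P) atTop
      (nhds (∫ ω, Complex.exp (Complex.I * b * roundHalfPi (totalWindingAngle fun m => X m ω)) ∂P)) := by
    refine tendsto_integral_of_dominated_convergence (fun _ => kernelBound (1 - b) 0) (fun n => ?_)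
      (integrable_const _) (fun n => ae_of_all _ fun ω => ?_) ?_
    · exact (measurable_coverHarmonic.comp (measurable_drivenOrbit measurable_coverStep _
        hX.measurable_increment n)).aestronglyMeasurable
    · exact (norm_coverHarmonic_le h0 h1 _).trans (kernelBound_le (by linarith) (by linarith) _)
    · filter_upwards [ae_coverOrbit_eventually hk hX] with ω hω
      refine tendsto_const_nhds.congr' ?_
      filter_upwards [hω] with n hn
      rw [hn, coverHarmonic_origin h0 h1]
  simp_rw [integral_coverHarmonic hk hX h0 h1] at hlim
  exact tendsto_nhds_unique hlim tendsto_const_nhds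

/-- At b = 0 both sides are 1. At b = 1 both are 0, the factor cos(π/2) removing the special value
`hDown (-1) k`. -/
lemma integral_exp_roundHalfPi_of_mem_Icc [IsProbabilityMeasure P] (hk : 1 ≤ k)
    (hX : IsSimpleRandomWalk P X ((k : ℤ), (k : ℤ))) {b : ℝ} (h0 : 0 ≤ b) (h1 : b ≤ 1) :
    ∫ ω, Complex.exp (Complex.I * b * roundHalfPi (totalWindingAngle fun m => X m ω)) ∂P =
      ((Real.cos (Real.pi * b / 2) * hDown (Real.cos (Real.pi * b)) k : ℝ) : ℂ) := by
  rcases h0.eq_or_lt with rfl | h0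
  · simp [hDown]
  · rw [integral_exp_roundHalfPi_of_pos hk hX h0 h1]
    rcases h1.eq_or_lt with rfl | h1
    · simp [boundarySeq_zero_even]
    · rw [sin_mul_boundarySeq h0 h1 hk]

/-- Since the rounded angle is π(j + 1/2), its multiple by 2m is mπ modulo 2π. A shift of β by 2m
thus only produces the sign (-1)^m. -/
lemma exp_two_mul_int_roundHalfPi (m : ℤ) (θ : ℝ) :
    Complex.exp (Complex.I * ((2 * m : ℝ) : ℂ) * roundHalfPi θ) = ((m.negOnePow : ℤ) : ℂ) := by
  rw [roundHalfPi, ← exp_int_mul_pi]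
  rw [show Complex.I * ((2 * m : ℝ) : ℂ) * ((Real.pi * ((⌊θ / Real.pi⌋ : ℝ) + 1 / 2) : ℝ) : ℂ) =
    m * Real.pi * Complex.I + ((m * ⌊θ / Real.pi⌋ : ℤ) : ℂ) * (2 * Real.pi * Complex.I) by push_cast; ring,
    Complex.exp_add, Complex.exp_int_mul_two_pi_mul_I, mul_one]

lemma cos_int_mul_pi_add (m : ℤ) (x : ℝ) :
    Real.cos (m * Real.pi + x) = ((m.negOnePow : ℤ) : ℝ) * Real.cos x := by
  rw [add_comm, Real.cos_add_int_mul_pi, Int.cast_negOnePow]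

/-- The characteristic function of the rounded winding angle. -/
lemma integral_exp_roundHalfPi [IsProbabilityMeasure P] (hk : 1 ≤ k)
    (hX : IsSimpleRandomWalk P X ((k : ℤ), (k : ℤ))) (β : ℝ) :
    ∫ ω, Complex.exp (Complex.I * β * roundHalfPi (totalWindingAngle fun m => X m ω)) ∂P =
      ((Real.cos (Real.pi * β / 2) * hDown (Real.cos (Real.pi * β)) k : ℝ) : ℂ) := by
  have hpi := Real.pi_pos
  -- This b ∈ [0,1] satisfies β = 2m ± b for an integer m. The minus sign amounts to complex
  -- conjugation, which fixes the real right-hand side.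
  set b := Real.arccos (Real.cos (Real.pi * β)) / Real.pi with hb
  have hb0 : 0 ≤ b := div_nonneg (Real.arccos_nonneg _) hpi.le
  have hb1 : b ≤ 1 := (div_le_one hpi).2 (Real.arccos_le_pi _)
  have hpb : Real.pi * b = Real.arccos (Real.cos (Real.pi * β)) := by rw [hb]; field_simp
  have hcos : Real.cos (Real.pi * b) = Real.cos (Real.pi * β) := by
    rw [hpb, Real.cos_arccos (Real.neg_one_le_cos _) (Real.cos_le_one _)]
  have hmain := integral_exp_roundHalfPi_of_mem_Icc hk hX hb0 hb1
  obtain ⟨m, hm⟩ := Real.cos_eq_cos_iff.1 hcos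
  rw [hcos] at hmain
  rcases hm with hm | hm
  · have hβ : β = 2 * m + b := by
      refine mul_left_cancel₀ hpi.ne' ?_
      rw [hm]; ring
    have hcos2 : Real.cos (Real.pi * β / 2) = ((m.negOnePow : ℤ) : ℝ) * Real.cos (Real.pi * b / 2) := by
      rw [← cos_int_mul_pi_add, hm]; congr 1; ring
    have hpt : ∀ ω, Complex.exp (Complex.I * β * roundHalfPi (totalWindingAngle fun m => X m ω)) =
        ((m.negOnePow : ℤ) : ℂ) *
          Complex.exp (Complex.I * b * roundHalfPi (totalWindingAngle fun m => X m ω)) := by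
      intro ω
      rw [← exp_two_mul_int_roundHalfPi m (totalWindingAngle fun m => X m ω), ← Complex.exp_add, hβ]
      push_cast
      ring_nf
    simp_rw [hpt]
    rw [integral_const_mul, hmain, hcos2]
    push_cast
    ring
  · have hβ : β = 2 * m - b := by
      refine mul_left_cancel₀ hpi.ne' ?_
      rw [hm]; ring
    have hcos2 : Real.cos (Real.pi * β / 2) = ((m.negOnePow : ℤ) : ℝ) * Real.cos (Real.pi * b / 2) := by
      rw [← Real.cos_neg (Real.pi * b / 2), ← cos_int_mul_pi_add, hm]; congr 1; ring
    have hpt : ∀ ω, Complex.exp (Complex.I * β * roundHalfPi (totalWindingAngle fun m => X m ω)) =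
        ((m.negOnePow : ℤ) : ℂ) * (starRingEnd ℂ)
          (Complex.exp (Complex.I * b * roundHalfPi (totalWindingAngle fun m => X m ω))) := by
      intro ω
      rw [← exp_two_mul_int_roundHalfPi m (totalWindingAngle fun m => X m ω), ← Complex.exp_conj,
        ← Complex.exp_add, hβ]
      simp only [map_mul, Complex.conj_I, Complex.conj_ofReal]
      push_cast
      ring_nf
    simp_rw [hpt]
    rw [integral_const_mul, integral_conj, hmain, hcos2, Complex.conj_ofReal]
    push_cast
    ring

end Winding

/-! ### The Cauchy characteristic function and the effect of rounding. -/

section CauchyLimit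

lemma integrable_exp_neg_two_pi_abs :
    Integrable fun x : ℝ => Complex.exp ((-(2 * Real.pi * |x|) : ℝ) : ℂ) := by
  have hpi := Real.pi_pos
  rw [← integrableOn_univ, ← Set.Iic_union_Ioi (a := (0 : ℝ))]
  refine IntegrableOn.union ?_ ?_
  · refine (integrableOn_exp_mul_complex_Iic (a := ((2 * Real.pi : ℝ) : ℂ)) (by rw [Complex.ofReal_re]; positivity) 0).congr_fun
      (fun x hx => ?_) measurableSet_Iic
    rw [Set.mem_Iic] at hx
    dsimp only
    rw [abs_of_nonpos hx]; push_cast; ring_nf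
  · refine (integrableOn_exp_mul_complex_Ioi (a := ((-(2 * Real.pi) : ℝ) : ℂ)) (by rw [Complex.ofReal_re]; linarith) 0).congr_fun
      (fun x hx => ?_) measurableSet_Ioi
    rw [Set.mem_Ioi] at hx
    dsimp only
    rw [abs_of_pos hx]; push_cast; ring_nf

-- The rate 2π is chosen so that, with the kernel e^{-2πixw}, the transform is exactly the standard
-- Cauchy density. Each half line contributes an elementary exponential integral.
open FourierTransform in
lemma fourier_exp_neg_two_pi_abs (w : ℝ) :
    𝓕 (fun x : ℝ => Complex.exp ((-(2 * Real.pi * |x|) : ℝ) : ℂ)) w =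
      ((Real.pi⁻¹ * (1 + w ^ 2)⁻¹ : ℝ) : ℂ) := by
  have hpi := Real.pi_pos
  rw [Real.fourier_real_eq_integral_exp_smul]
  have hL : Set.EqOn (fun v : ℝ => Complex.exp (((-2 * Real.pi * v * w : ℝ) : ℂ) * Complex.I) •
      Complex.exp ((-(2 * Real.pi * |v|) : ℝ) : ℂ))
      (fun v : ℝ => Complex.exp ((2 * Real.pi * (1 - w * Complex.I)) * v)) (Set.Iic 0) := by
    intro v hv
    rw [Set.mem_Iic] at hv
    dsimp only
    rw [smul_eq_mul, ← Complex.exp_add, abs_of_nonpos hv]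
    congr 1; push_cast; ring
  have hR : Set.EqOn (fun v : ℝ => Complex.exp (((-2 * Real.pi * v * w : ℝ) : ℂ) * Complex.I) •
      Complex.exp ((-(2 * Real.pi * |v|) : ℝ) : ℂ))
      (fun v : ℝ => Complex.exp ((-(2 * Real.pi * (1 + w * Complex.I))) * v)) (Set.Ioi 0) := by
    intro v hv
    rw [Set.mem_Ioi] at hv
    dsimp only
    rw [smul_eq_mul, ← Complex.exp_add, abs_of_pos hv]
    congr 1; push_cast; ring
  have hreL : 0 < (2 * Real.pi * (1 - w * Complex.I) : ℂ).re := by simp [hpi]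
  have hreR : (-(2 * Real.pi * (1 + w * Complex.I)) : ℂ).re < 0 := by simp [hpi]
  have hiL := integrableOn_exp_mul_complex_Iic hreL 0
  have hiR := integrableOn_exp_mul_complex_Ioi hreR 0
  rw [← intervalIntegral.integral_Iic_add_Ioi (b := 0) (hiL.congr_fun hL.symm measurableSet_Iic)
    (hiR.congr_fun hR.symm measurableSet_Ioi), setIntegral_congr_fun measurableSet_Iic hL,
    setIntegral_congr_fun measurableSet_Ioi hR, integral_exp_mul_complex_Iic hreL,
    integral_exp_mul_complex_Ioi hreR]
  have h1 : (1 - w * Complex.I : ℂ) ≠ 0 := fun h => by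
    have := congrArg Complex.re h; simp at this
  have h2 : (1 + w * Complex.I : ℂ) ≠ 0 := fun h => by
    have := congrArg Complex.re h; simp at this
  have h3 : (1 + (w : ℂ) ^ 2) ≠ 0 := by
    have : (1 + w ^ 2 : ℝ) ≠ 0 := by positivity
    exact_mod_cast this
  have h4 : (Real.pi : ℂ) ≠ 0 := by exact_mod_cast hpi.ne'
  simp only [Complex.ofReal_zero, mul_zero, Complex.exp_zero]
  push_cast
  field_simp
  linear_combination (2 * (w : ℂ) ^ 2) * Complex.I_sq

open FourierTransform in
/-- The characteristic function of the standard Cauchy distribution. -/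
lemma charFun_cauchyMeasure (t : ℝ) :
    charFun (cauchyMeasure 0 1) t = ((Real.exp (-|t|) : ℝ) : ℂ) := by
  have hpi := Real.pi_pos
  set f : ℝ → ℂ := fun x : ℝ => Complex.exp ((-(2 * Real.pi * |x|) : ℝ) : ℂ) with hf
  have hF : 𝓕 f = fun w : ℝ => ((Real.pi⁻¹ * (1 + w ^ 2)⁻¹ : ℝ) : ℂ) :=
    funext fourier_exp_neg_two_pi_abs
  have hFi : Integrable (𝓕 f) := by
    rw [hF]
    exact (integrable_inv_one_add_sq.const_mul _).ofReal
  -- Inversion is evaluated at t/(2π), so that the kernel e^{2πiwx} becomes e^{itw}.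
  have hinv := congrFun (Continuous.fourierInv_fourier_eq (f := f) (by fun_prop)
    integrable_exp_neg_two_pi_abs hFi) (t / (2 * Real.pi))
  rw [hF, Real.fourierInv_eq'] at hinv
  have hval : f (t / (2 * Real.pi)) = ((Real.exp (-|t|) : ℝ) : ℂ) := by
    rw [hf, Complex.ofReal_exp]
    dsimp only
    rw [abs_div, abs_of_pos (by positivity : 0 < 2 * Real.pi)]
    congr 3
    field_simp
  rw [hval] at hinv
  rw [← hinv, charFun_apply_real, cauchyMeasure_of_scale_ne_zero 0 one_ne_zero,
    integral_withDensity_eq_integral_toReal_smul (measurable_cauchyPDF _ _)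
      (ae_of_all _ fun x => ENNReal.ofReal_lt_top)]
  refine integral_congr_ae (ae_of_all _ fun x => ?_)
  have hx : (cauchyPDF 0 1 x).toReal = Real.pi⁻¹ * (1 + x ^ 2)⁻¹ := by
    rw [cauchyPDF_def, ENNReal.toReal_ofReal (by rw [cauchyPDFReal_def]; positivity), cauchyPDFReal_def]
    simp [add_comm]
  dsimp only
  rw [hx, Complex.real_smul, smul_eq_mul, mul_comm]
  congr 2
  simp only [inner, star_trivial, RCLike.re_to_real]
  push_cast
  field_simp

lemma abs_sub_roundHalfPi_le (θ : ℝ) : |θ - roundHalfPi θ| ≤ Real.pi / 2 := by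
  have hpi := Real.pi_pos
  have h1 := (le_div_iff₀ hpi).1 (Int.floor_le (θ / Real.pi))
  have h2 := (div_lt_iff₀ hpi).1 (Int.lt_floor_add_one (θ / Real.pi))
  rw [roundHalfPi, abs_le]
  constructor <;> linarith

lemma norm_exp_sub_exp_le (x y : ℝ) :
    ‖Complex.exp (Complex.I * x) - Complex.exp (Complex.I * y)‖ ≤ |x - y| := by
  have h : Complex.exp (Complex.I * x) - Complex.exp (Complex.I * y) =
      Complex.exp (Complex.I * y) * (Complex.exp (Complex.I * ((x - y : ℝ) : ℂ)) - 1) := by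
    rw [mul_sub, ← Complex.exp_add, mul_one]
    push_cast
    ring_nf
  rw [h, norm_mul, mul_comm Complex.I (y : ℂ), Complex.norm_exp_ofReal_mul_I, one_mul]
  exact Real.norm_exp_I_mul_ofReal_sub_one_le

/-- The limit of the characteristic functions, from its values at positive arguments. -/
lemma tendsto_cos_mul_hDown_abs (t : ℝ) :
    Tendsto (fun k : ℕ => Real.cos (Real.pi * (t / Real.log k) / 2) *
      hDown (Real.cos (Real.pi * (t / Real.log k))) k) atTop (nhds (Real.exp (-|t|))) := by
  rcases lt_trichotomy t 0 with ht | rfl | ht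
  · have h := tendsto_cos_mul_hDown_div_log (neg_pos.2 ht)
    rw [abs_of_neg ht]
    refine h.congr fun k => ?_
    rw [← Real.cos_neg, ← Real.cos_neg (Real.pi * (-t / Real.log k))]
    ring_nf
  · refine tendsto_const_nhds.congr fun k => ?_
    simp [hDown]
  · rw [abs_of_pos ht]
    exact tendsto_cos_mul_hDown_div_log ht

end CauchyLimit

/-! ### The exact formula and the convergence in distribution. -/

theorem theorem6 {Ω : ℕ → Type*} [∀ k, MeasurableSpace (Ω k)]
    (P : ∀ k, Measure (Ω k)) [∀ k, IsProbabilityMeasure (P k)]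
    (X : ∀ k, ℕ → Ω k → ℤ × ℤ)
    (hX : ∀ k : ℕ, 1 ≤ k → IsSimpleRandomWalk (P k) (X k) ((k : ℤ), (k : ℤ))) :
    (∀ k : ℕ, 1 ≤ k →
      (∀ᵐ ω ∂(P k), ∃ n, X k n ω = 0) ∧
      ∀ β : ℝ,
        ∫ ω, Complex.exp
            (Complex.I * (β : ℂ) * ((roundHalfPi (totalWindingAngle fun n => X k n ω) : ℝ) : ℂ))
          ∂(P k) =
        ((Real.cos (Real.pi * β / 2) * hDown (Real.cos (Real.pi * β)) k : ℝ) : ℂ)) ∧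
    TendstoInDistribution
      (fun (k : ℕ) (ω : Ω k) => totalWindingAngle (fun n => X k n ω) / Real.log k)
      atTop (id : ℝ → ℝ) P (cauchyMeasure 0 1) := by
  refine ⟨fun k hk => ⟨ae_hits hk (hX k hk), integral_exp_roundHalfPi hk (hX k hk)⟩, ?_⟩
  have hΘ : ∀ k, 1 ≤ k → AEMeasurable (fun ω => totalWindingAngle fun n => X k n ω) (P k) :=
    fun k hk => aemeasurable_totalWindingAngle hk (hX k hk)
  have hm : ∀ k : ℕ, AEMeasurable
      (fun ω => totalWindingAngle (fun n => X k n ω) / Real.log k) (P k) := by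
    intro k
    rcases Nat.eq_zero_or_pos k with rfl | hk
    -- At k = 0 nothing is known about the walk, but log 0 = 0 and division by 0 gives the constant
    -- 0.
    · simp
    · exact (hΘ k hk).div_const _
  refine ⟨hm, aemeasurable_id, ?_⟩
  refine ProbabilityMeasure.tendsto_iff_tendsto_charFun.2 fun t => ?_
  have hlog : Tendsto (fun k : ℕ => Real.log k) atTop atTop :=
    Real.tendsto_log_atTop.comp tendsto_natCast_atTop_atTop
  have hlim : Tendsto (fun k : ℕ => ((Real.cos (Real.pi * (t / Real.log k) / 2) *
      hDown (Real.cos (Real.pi * (t / Real.log k))) k : ℝ) : ℂ)) atTop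
      (nhds (charFun (cauchyMeasure 0 1) t)) := by
    rw [charFun_cauchyMeasure]
    exact (Complex.continuous_ofReal.tendsto _).comp (tendsto_cos_mul_hDown_abs t)
  rw [← Measure.map_id (μ := cauchyMeasure 0 1)] at hlim
  change Tendsto (fun k => charFun ((P k).map fun ω =>
    totalWindingAngle (fun n => X k n ω) / Real.log k) t) atTop
    (nhds (charFun ((cauchyMeasure 0 1).map id) t))
  -- The exact formula at β = t / log k concerns [Θ] / log k. Passing to Θ / log k changes the
  -- characteristic function by at most |t| (π/2) / log k.
  refine (tendsto_iff_of_dist ?_).1 hlim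
  have hbound : Tendsto (fun k : ℕ => |t| * (Real.pi / 2) / Real.log k) atTop (nhds 0) :=
    hlog.const_div_atTop _
  refine squeeze_zero' (Eventually.of_forall fun _ => dist_nonneg) ?_ hbound
  filter_upwards [eventually_ge_atTop 2] with k hk
  have hk1 : (1 : ℝ) < k := by exact_mod_cast hk
  have hl : 0 < Real.log k := Real.log_pos hk1
  have hk0 : 1 ≤ k := by omega
  rw [← integral_exp_roundHalfPi hk0 (hX k hk0) (t / Real.log k)]
  rw [charFun_apply_real, integral_map (hm k) (by fun_prop), dist_eq_norm,
    ← integral_sub]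
  · have h2 := norm_integral_le_of_norm_le_const (μ := P k) (C := |t| * (Real.pi / 2) / Real.log k)
      (f := fun ω => Complex.exp (Complex.I * ((t / Real.log k : ℝ) : ℂ) *
        ((roundHalfPi (totalWindingAngle fun n => X k n ω) : ℝ) : ℂ)) -
        Complex.exp (t * ((totalWindingAngle (fun n => X k n ω) / Real.log k : ℝ) : ℂ) * Complex.I))
      (ae_of_all _ fun ω => ?_)
    · simpa using h2
    · set θ := totalWindingAngle fun n => X k n ω
      have e1 : Complex.I * ((t / Real.log k : ℝ) : ℂ) * ((roundHalfPi θ : ℝ) : ℂ) =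
          Complex.I * ((t / Real.log k * roundHalfPi θ : ℝ) : ℂ) := by push_cast; ring
      have e2 : t * ((θ / Real.log k : ℝ) : ℂ) * Complex.I =
          Complex.I * ((t / Real.log k * θ : ℝ) : ℂ) := by push_cast; ring
      rw [e1, e2]
      refine (norm_exp_sub_exp_le _ _).trans ?_
      rw [← mul_sub, abs_mul, abs_div, abs_of_pos hl, abs_sub_comm]
      have := abs_sub_roundHalfPi_le θ
      calc |t| / Real.log k * |θ - roundHalfPi θ| ≤ |t| / Real.log k * (Real.pi / 2) :=
            mul_le_mul_of_nonneg_left this (by positivity)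
        _ = _ := by ring
  · refine Integrable.of_bound (C := 1) ?_ (ae_of_all _ fun ω => (norm_exp_I_mul_mul _ _).le)
    have h3 : AEMeasurable (fun ω => ((roundHalfPi (totalWindingAngle fun n => X k n ω) : ℝ) : ℂ)) (P k) :=
      Complex.measurable_ofReal.comp_aemeasurable (measurable_roundHalfPi.comp_aemeasurable (hΘ k hk0))
    exact (Complex.measurable_exp.comp_aemeasurable (h3.const_mul _)).aestronglyMeasurable
  · refine Integrable.of_bound (C := 1) ?_ (ae_of_all _ fun ω => ?_)
    · have h3 : AEMeasurable (fun ω => ((totalWindingAngle (fun n => X k n ω) / Real.log k : ℝ) : ℂ)) (P k) :=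
        Complex.measurable_ofReal.comp_aemeasurable (hm k)
      exact (Complex.measurable_exp.comp_aemeasurable
        ((h3.const_mul _).mul_const _)).aestronglyMeasurable
    · rw [← Complex.ofReal_mul, Complex.norm_exp_ofReal_mul_I]
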